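/- Let $D$ be an integral domain with quotient field $K$ (fields are allowed). For a nonzero fractional ideal $I$ of $D$ put $I^{-1}=\{x\in K: xI\subseteq D\}$, $I_v=(I^{-1})^{-1}$, and let $I_t$ be the union of the $J_v$ over all nonzero finitely generated fractional ideals $J\subseteq I$. A nonzero ideal $I$ of $D$ is a $t$-ideal if $I_t=I$, and a maximal $t$-ideal is a proper $t$-ideal that is maximal among the proper $t$-ideals (such an ideal is prime). We say that $D$ is - a PVMD (Prüfer $v$-multiplication domain) if $(II^{-1})_t=D$ for every nonzero finitely generated fractional ideal $I$; - an H-domain if for every nonzero ideal $I$ of $D$ with $I^{-1}=D$ there is a finitely generated ideal $F\subseteq I$ with $F^{-1}=D$, where $F\neq(0)$; - completely integrally closed if every $x\in K$, for which there is a nonzero $r\in D$ with $rx^n\in D$ for all $n\geq 1$, lies in $D$; - a Krull domain if $D$ is the intersection in $K$ of a (possibly empty) family of discrete rank-one valuation rings of $K$ such that each nonzero element of $D$ is a nonunit in only finitely many of them; - a Krull-like PVMD if $D$ is a PVMD, the localization $D_M$ is a strongly discrete valuation domain (a valuation domain in which $P\neq P^2$ for every nonzero prime ideal $P$) for every maximal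 $t$-ideal $M$ of $D$, and every principal ideal of $D$ has only finitely many minimal prime ideals. (a) If $D$ is an H-domain, then the following statements are equivalent: 1. $D[[X]]$ is a PVMD; 2. $D$ is completely integrally closed; 3. $D$ is a Krull domain; 4. $D[[X]]$ is completely integrally closed. (b) If $D$ is a Krull-like PVMD, then $D[[X]]$ is a Krull-like PVMD if and only if $D$ is a Krull domain. -/

import Mathlib

open scoped nonZeroDivisors PowerSeries

section StarOperations

variable {D : Type*} [CommRing D] [IsDomain D]

/-- The `v`-closure `I_v = (I⁻¹)⁻¹` of a nonzero fractional ideal `I` of `D`, where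
`I⁻¹ = (D :_K I)` and `K` is the quotient field of `D`. -/
noncomputable def vClosure (I : FractionalIdeal D⁰ (FractionRing D)) :
    FractionalIdeal D⁰ (FractionRing D) :=
  (I⁻¹)⁻¹

/-- The `t`-closure of a nonzero fractional ideal `I`: the union of the `J_v`, where `J` runs
over the nonzero finitely generated fractional ideals contained in `I`. -/
def tClosure (I : FractionalIdeal D⁰ (FractionRing D)) : Set (FractionRing D) :=
  {x | ∃ J : FractionalIdeal D⁰ (FractionRing D),
    J ≠ 0 ∧ (J : Submodule D (FractionRing D)).FG ∧ J ≤ I ∧ x ∈ vClosure J}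

/-- A nonzero fractional ideal `I` is `t`-invertible if `(I I⁻¹)_t = D`. -/
def IsTInvertible (I : FractionalIdeal D⁰ (FractionRing D)) : Prop :=
  tClosure (I * I⁻¹) =
    ((1 : FractionalIdeal D⁰ (FractionRing D)) : Set (FractionRing D))

/-- A nonzero ideal `I` of `D` is an (integral) `t`-ideal if `I_t = I`. -/
def IsTIdeal (I : Ideal D) : Prop :=
  I ≠ ⊥ ∧ tClosure (I : FractionalIdeal D⁰ (FractionRing D)) =
    ((I : FractionalIdeal D⁰ (FractionRing D)) : Set (FractionRing D))

/-- A maximal `t`-ideal: maximal among the proper integral `t`-ideals. -/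
def IsMaximalTIdeal (M : Ideal D) : Prop :=
  IsTIdeal M ∧ M ≠ ⊤ ∧ ∀ N : Ideal D, IsTIdeal N → N ≠ ⊤ → M ≤ N → N = M

end StarOperations

section Domains

variable (D : Type*) [CommRing D] [IsDomain D]

/-- A Prüfer `v`-multiplication domain: every nonzero finitely generated fractional ideal is
`t`-invertible. -/
def IsPVMD : Prop :=
  ∀ I : FractionalIdeal D⁰ (FractionRing D),
    I ≠ 0 → (I : Submodule D (FractionRing D)).FG → IsTInvertible I

/-- An H-domain: every nonzero ideal `I` with `I⁻¹ = D` contains a finitely generated ideal `F`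
with `F⁻¹ = D`. -/
def IsHDomain : Prop :=
  ∀ I : Ideal D, I ≠ ⊥ → (I : FractionalIdeal D⁰ (FractionRing D))⁻¹ = 1 →
    ∃ F : Ideal D, F ≠ ⊥ ∧ F.FG ∧ F ≤ I ∧
      (F : FractionalIdeal D⁰ (FractionRing D))⁻¹ = 1

/-- `D` is completely integrally closed: if `x` is in the quotient field and there is a nonzero
`r ∈ D` with `r x ^ n ∈ D` for all `n`, then `x ∈ D`. -/
def IsCompletelyIntegrallyClosed : Prop :=
  ∀ x : FractionRing D, IsAlmostIntegral D x → x ∈ (algebraMap D (FractionRing D)).range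

/-- A Krull domain: `D` is the intersection of a family of discrete rank-one valuation rings of its
quotient field, such that each nonzero element of `D` is a nonunit in only finitely many members
of the family. The empty family has intersection the quotient field, so fields are included. -/
def IsKrullDomain : Prop :=
  ∃ 𝓕 : Set (ValuationSubring (FractionRing D)),
    (∀ V ∈ 𝓕, IsDiscreteValuationRing V) ∧
    (∀ x : FractionRing D, x ∈ (algebraMap D (FractionRing D)).range ↔ ∀ V ∈ 𝓕, x ∈ V) ∧
    ∀ d : D, d ≠ 0 → {V ∈ 𝓕 | (algebraMap D (FractionRing D) d)⁻¹ ∉ V}.Finite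

/-- A strongly discrete valuation domain: a valuation domain in which no nonzero prime ideal is
idempotent. -/
def IsStronglyDiscreteValuationDomain (V : Type*) [CommRing V] : Prop :=
  ∃ _ : IsDomain V, ValuationRing V ∧ ∀ P : Ideal V, P.IsPrime → P ≠ ⊥ → P ≠ P ^ 2

/-- A Krull-like PVMD: a PVMD such that `D_M` is a strongly discrete valuation domain for every
maximal `t`-ideal `M` (these are always prime) and every principal ideal has only finitely many
minimal prime ideals. -/
def IsKrullLikePVMD : Prop :=
  IsPVMD D ∧
    (∀ (M : Ideal D) [M.IsPrime], IsMaximalTIdeal M →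
      IsStronglyDiscreteValuationDomain (Localization.AtPrime M)) ∧
    ∀ a : D, (Ideal.span {a}).minimalPrimes.Finite

end Domains

/-! Everything is phrased by divisibility: `I_t = D` means that `I` contains a nonzero finitely
generated `F` such that `b ∣ a * f` for all `f ∈ F` forces `b ∣ a`, whenever `b ≠ 0`. Maximal
`t`-ideals are the nonzero ideals maximal among those without such an `F`. They are prime, and
divisibility in `D` can be tested locally at them.

The hard implication is from `D⟦X⟧` a PVMD to `D` completely integrally closed. Let `r x ^ n ∈ D`
for all `n`. The Catalan series `w = xX + w²` has coefficients that are integer multiples of powers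
of `x`, so `r w ∈ D⟦X⟧`. If `b, bx ∈ D`, then `Y = bw` satisfies the monic equation `Y² = bY -
b(bx)X`. A PVMD is integrally closed, so `bw ∈ D⟦X⟧`, and its coefficient at `X²` gives `bx² ∈ D`.
Hence `x` multiplies `(1, x)(1, x)⁻¹`, formed over `D⟦X⟧`, into `D⟦X⟧`. As `(1, x)` is
`t`-invertible, `x` lies in `D⟦X⟧`, and so in `D`.

In a completely integrally closed H-domain every nonzero fractional ideal is `t`-invertible. Maximal
`t`-ideals then have discrete rank-one localizations, with finite character, so the domain is Krull
and a Krull-like PVMD. If `D` is Krull, then `D⟦X⟧` is such a domain: complete integral closure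
passes to power series coefficient by coefficient, and `D⟦X⟧` is an intersection of finite character
of Noetherian overrings.

For the remaining half of (b), a completely integrally closed Krull-like PVMD is Krull: an
infinitely `m`-divisible element at a maximal `t`-ideal with local generator `m` would produce an
almost integral element outside `D`. -/

set_option linter.unusedSectionVars false

/-! ### Maximal `t`-ideals and `t`-invertibility -/

section TOperation

variable {D : Type*} [CommRing D] [IsDomain D]

/-- The inverse of the ideal `F` is contained in `D`, phrased by divisibility. -/
def Ideal.InvTrivial (F : Ideal D) : Prop :=
  ∀ a b : D, b ≠ 0 → (∀ f ∈ F, b ∣ a * f) → b ∣ a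

/-- `I` contains a nonzero finitely generated ideal with trivial inverse, i.e. `I_t = D`. -/
def Ideal.HasDenseFG (I : Ideal D) : Prop :=
  ∃ F : Ideal D, F ≠ ⊥ ∧ F.FG ∧ F ≤ I ∧ F.InvTrivial

lemma algebraMap_div_mem_one_iff {a b : D} (hb : b ≠ 0) :
    algebraMap D (FractionRing D) a / algebraMap D (FractionRing D) b ∈
      (1 : FractionalIdeal D⁰ (FractionRing D)) ↔ b ∣ a := by
  have hb' : algebraMap D (FractionRing D) b ≠ 0 := by simpa using hb
  rw [FractionalIdeal.mem_one_iff]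
  constructor
  · rintro ⟨c, hc⟩
    rw [eq_div_iff hb', ← map_mul] at hc
    exact ⟨c, by rw [← IsFractionRing.injective D (FractionRing D) hc, mul_comm]⟩
  · rintro ⟨c, rfl⟩
    exact ⟨c, by rw [eq_div_iff hb', map_mul, mul_comm]⟩

lemma inv_le_one_iff {F : Ideal D} (hF : F ≠ ⊥) :
    (F : FractionalIdeal D⁰ (FractionRing D))⁻¹ ≤ 1 ↔ F.InvTrivial := by
  have hF' : (F : FractionalIdeal D⁰ (FractionRing D)) ≠ 0 :=
    FractionalIdeal.coeIdeal_ne_zero.2 hF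
  constructor
  · intro h a b hb hab
    rw [← algebraMap_div_mem_one_iff hb]
    apply h
    rw [FractionalIdeal.mem_inv_iff hF']
    intro y hy
    obtain ⟨f, hf, rfl⟩ := (FractionalIdeal.mem_coeIdeal _).1 hy
    rw [div_mul_eq_mul_div, ← map_mul, algebraMap_div_mem_one_iff hb]
    exact hab f hf
  · intro h x hx
    rw [FractionalIdeal.mem_inv_iff hF'] at hx
    obtain ⟨a, b, hb, rfl⟩ := IsFractionRing.div_surjective (A := D) x
    have hb := nonZeroDivisors.ne_zero hb
    rw [algebraMap_div_mem_one_iff hb]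
    refine h a b hb fun f hf => ?_
    rw [← algebraMap_div_mem_one_iff hb, map_mul, ← div_mul_eq_mul_div]
    exact hx _ (FractionalIdeal.mem_coeIdeal_of_mem _ hf)

lemma one_le_inv {J : FractionalIdeal D⁰ (FractionRing D)} (h0 : J ≠ 0) (h : J ≤ 1) :
    1 ≤ J⁻¹ := by
  rw [FractionalIdeal.one_le, FractionalIdeal.mem_inv_iff h0]
  intro y hy
  rw [one_mul]
  exact h hy

lemma inv_ne_zero_of_ne_zero {J : FractionalIdeal D⁰ (FractionRing D)} (h0 : J ≠ 0) :
    J⁻¹ ≠ 0 := by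
  intro h
  have := FractionalIdeal.den_mem_inv h0
  rw [h, FractionalIdeal.mem_zero_iff] at this
  have h2 := nonZeroDivisors.ne_zero J.den.2
  simp at this

lemma inv_eq_one_iff {F : Ideal D} (hF : F ≠ ⊥) :
    (F : FractionalIdeal D⁰ (FractionRing D))⁻¹ = 1 ↔ F.InvTrivial := by
  rw [← inv_le_one_iff hF, le_antisymm_iff, and_iff_left]
  exact one_le_inv (FractionalIdeal.coeIdeal_ne_zero.2 hF) FractionalIdeal.coeIdeal_le_one

lemma one_mem_vClosure_iff {J : FractionalIdeal D⁰ (FractionRing D)} (h0 : J ≠ 0) :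
    1 ∈ vClosure J ↔ J⁻¹ ≤ 1 := by
  rw [vClosure, FractionalIdeal.mem_inv_iff (I := J⁻¹) (inv_ne_zero_of_ne_zero h0)]
  simp only [one_mul]
  rfl

lemma vClosure_le_one {J : FractionalIdeal D⁰ (FractionRing D)} (h0 : J ≠ 0) (h : J ≤ 1) :
    vClosure J ≤ 1 := by
  have := FractionalIdeal.inv_anti_mono (I := 1) (J := J⁻¹) one_ne_zero
    (inv_ne_zero_of_ne_zero h0) (one_le_inv h0 h)
  rwa [inv_one] at this

lemma le_vClosure {J : FractionalIdeal D⁰ (FractionRing D)} (h0 : J ≠ 0) : J ≤ vClosure J := by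
  intro x hx
  rw [vClosure, FractionalIdeal.mem_inv_iff (I := J⁻¹) (inv_ne_zero_of_ne_zero h0)]
  intro y hy
  rw [mul_comm]
  exact (FractionalIdeal.mem_inv_iff h0).1 hy x hx

lemma one_mem_tClosure_iff {I : Ideal D} :
    1 ∈ tClosure (I : FractionalIdeal D⁰ (FractionRing D)) ↔ I.HasDenseFG := by
  constructor
  · rintro ⟨J, h0, hfg, hJ, h1⟩
    obtain ⟨F, rfl⟩ := FractionalIdeal.le_one_iff_exists_coeIdeal.1
      (hJ.trans FractionalIdeal.coeIdeal_le_one)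
    have hF : F ≠ ⊥ := FractionalIdeal.coeIdeal_ne_zero.1 h0
    refine ⟨F, hF, ?_, (FractionalIdeal.coeIdeal_le_coeIdeal _).1 hJ,
      (inv_le_one_iff hF).1 ((one_mem_vClosure_iff h0).1 h1)⟩
    rwa [FractionalIdeal.coeIdeal_fg D⁰ (IsFractionRing.injective D (FractionRing D))] at hfg
  · rintro ⟨F, h0, hfg, hF, hi⟩
    have h0' := (FractionalIdeal.coeIdeal_ne_zero (K := FractionRing D)).2 h0
    refine ⟨F, h0', ?_,
      (FractionalIdeal.coeIdeal_le_coeIdeal _).2 hF,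
      (one_mem_vClosure_iff h0').2 ((inv_le_one_iff h0).2 hi)⟩
    rwa [FractionalIdeal.coeIdeal_fg D⁰ (IsFractionRing.injective D (FractionRing D))]

lemma tClosure_eq_one_iff {I : Ideal D} :
    tClosure (I : FractionalIdeal D⁰ (FractionRing D)) =
      ((1 : FractionalIdeal D⁰ (FractionRing D)) : Set (FractionRing D)) ↔ I.HasDenseFG := by
  rw [← one_mem_tClosure_iff]
  constructor
  · intro h
    rw [h]
    exact FractionalIdeal.one_mem_one _
  · rintro ⟨J, h0, hfg, hJ, h1⟩
    apply Set.Subset.antisymm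
    · rintro x ⟨J, h0, hfg, hJ, hx⟩
      exact vClosure_le_one h0 (hJ.trans FractionalIdeal.coeIdeal_le_one) hx
    · intro x hx
      exact ⟨J, h0, hfg, hJ, FractionalIdeal.one_le.2 h1 hx⟩

lemma isHDomain_iff : IsHDomain D ↔ ∀ I : Ideal D, I ≠ ⊥ → I.InvTrivial → I.HasDenseFG := by
  constructor
  · intro h I hI hi
    obtain ⟨F, h0, h1, h2, h3⟩ := h I hI ((inv_eq_one_iff hI).2 hi)
    exact ⟨F, h0, h1, h2, (inv_eq_one_iff h0).1 h3⟩
  · intro h I hI hi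
    obtain ⟨F, h0, h1, h2, h3⟩ := h I hI ((inv_eq_one_iff hI).1 hi)
    exact ⟨F, h0, h1, h2, (inv_eq_one_iff h0).2 h3⟩

namespace Ideal

lemma InvTrivial.mono {F G : Ideal D} (h : F ≤ G) (hF : F.InvTrivial) : G.InvTrivial :=
  fun a b hb hab => hF a b hb fun f hf => hab f (h hf)

lemma HasDenseFG.mono {I J : Ideal D} (h : I ≤ J) : I.HasDenseFG → J.HasDenseFG :=
  fun ⟨F, h0, h1, h2, h3⟩ => ⟨F, h0, h1, h2.trans h, h3⟩

lemma HasDenseFG.invTrivial {I : Ideal D} : I.HasDenseFG → I.InvTrivial :=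
  fun ⟨_, _, _, h2, h3⟩ => h3.mono h2

lemma hasDenseFG_top : (⊤ : Ideal D).HasDenseFG :=
  ⟨⊤, top_ne_bot, ⟨{1}, by simp⟩, le_rfl, fun a b _ h => by
    simpa using h 1 trivial⟩

lemma HasDenseFG.mul {I J : Ideal D} : I.HasDenseFG → J.HasDenseFG → (I * J).HasDenseFG := by
  rintro ⟨F, h0, h1, h2, h3⟩ ⟨G, k0, k1, k2, k3⟩
  refine ⟨F * G, mul_ne_zero h0 k0, h1.mul k1, Ideal.mul_mono h2 k2, fun a b hb h => ?_⟩
  refine h3 a b hb fun f hf => k3 _ b hb fun g hg => ?_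
  rw [mul_assoc]
  exact h _ (Ideal.mul_mem_mul hf hg)

/-- Ideals maximal among the nonzero ideals whose `t`-closure is proper. -/
def IsMaximalProperT (M : Ideal D) : Prop :=
  M ≠ ⊥ ∧ ¬ M.HasDenseFG ∧ ∀ N : Ideal D, M ≤ N → ¬ N.HasDenseFG → N = M

/-- Zorn applies because the witness is finitely generated: a witness inside the union of a chain
already lies in one member. -/
lemma exists_le_isMaximalProperT {A : Ideal D} (h0 : A ≠ ⊥) (h : ¬ A.HasDenseFG) :
    ∃ M, A ≤ M ∧ M.IsMaximalProperT := by
  obtain ⟨M, hAM, hM⟩ := zorn_le_nonempty₀ {N : Ideal D | ¬ N.HasDenseFG} (fun c hc hcc y hy => by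
    refine ⟨sSup c, ?_, fun z hz => le_sSup hz⟩
    rintro ⟨F, f0, ⟨s, rfl⟩, f2, f3⟩
    have : ∃ N ∈ c, (s : Set D) ⊆ N := by
      apply DirectedOn.exists_mem_subset_of_finset_subset_biUnion ⟨y, hy⟩ hcc.directedOn
      intro x hx
      obtain ⟨N, hN, hx⟩ := (Submodule.mem_sSup_of_directed ⟨y, hy⟩ hcc.directedOn).1
        (f2 (Ideal.subset_span hx))
      simp only [Set.mem_iUnion]
      exact ⟨N, hN, hx⟩
    obtain ⟨N, hN, hs⟩ := this
    exact hc hN ⟨_, f0, ⟨s, rfl⟩, Ideal.span_le.2 hs, f3⟩) A h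
  refine ⟨M, hAM, ?_, hM.prop, fun N hMN hN => le_antisymm (hM.le_of_ge hN hMN) hMN⟩
  rintro rfl
  exact h0 (le_bot_iff.1 hAM)

lemma IsMaximalProperT.isPrime {M : Ideal D} (hM : M.IsMaximalProperT) : M.IsPrime := by
  refine ⟨fun h => hM.2.1 (h ▸ hasDenseFG_top), fun {x y} hxy => ?_⟩
  by_contra! hcon
  have key : ∀ z ∉ M, (M ⊔ span {z}).HasDenseFG := by
    intro z hz
    by_contra hd
    have := hM.2.2 _ le_sup_left hd
    exact hz (this ▸ le_sup_right (a := M) (Ideal.mem_span_singleton_self z))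
  refine hM.2.1 (HasDenseFG.mono ?_ ((key x hcon.1).mul (key y hcon.2)))
  rw [Ideal.sup_mul, Ideal.mul_sup, Ideal.mul_sup, Ideal.span_singleton_mul_span_singleton]
  refine sup_le (sup_le Ideal.mul_le_left Ideal.mul_le_left)
    (sup_le Ideal.mul_le_right ?_)
  rwa [Ideal.span_singleton_le_iff_mem]

end Ideal

/-- If `y ∈ F_v` with `F ⊆ M` finitely generated and `y ∉ M`, then `M + (y)` contains a dense
finitely generated ideal. Replacing `y` by the generators of `F` moves that ideal inside `M`, a
contradiction. -/
lemma Ideal.IsMaximalProperT.isTIdeal {M : Ideal D} (hM : M.IsMaximalProperT) : IsTIdeal M := by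
  refine ⟨hM.1, ?_⟩
  apply Set.Subset.antisymm
  · rintro x ⟨J, h0, hfg, hJ, hx⟩
    obtain ⟨y, rfl⟩ := (FractionalIdeal.mem_one_iff _).1
      (vClosure_le_one h0 (hJ.trans FractionalIdeal.coeIdeal_le_one) hx)
    obtain ⟨F, rfl⟩ := FractionalIdeal.le_one_iff_exists_coeIdeal.1
      (hJ.trans FractionalIdeal.coeIdeal_le_one)
    have hF : F ≠ ⊥ := FractionalIdeal.coeIdeal_ne_zero.1 h0
    rw [FractionalIdeal.coeIdeal_fg D⁰ (IsFractionRing.injective D (FractionRing D))] at hfg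
    rw [FractionalIdeal.coeIdeal_le_coeIdeal] at hJ
    by_contra hy
    have hyM : y ∉ M := fun h => hy (FractionalIdeal.mem_coeIdeal_of_mem _ h)
    have : (M ⊔ span {y}).HasDenseFG := by
      by_contra hd
      have := hM.2.2 _ le_sup_left hd
      exact hyM (this ▸ le_sup_right (a := M) (Ideal.mem_span_singleton_self y))
    obtain ⟨G, g0, ⟨s, rfl⟩, g2, g3⟩ := this
    have : ∀ g ∈ s, ∃ m ∈ M, ∃ c, m + c * y = g := by
      intro g hg
      obtain ⟨m, hm, z, hz, rfl⟩ := Submodule.mem_sup.1 (g2 (Ideal.subset_span hg))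
      obtain ⟨c, rfl⟩ := Ideal.mem_span_singleton'.1 hz
      exact ⟨m, hm, c, rfl⟩
    choose! m hm c hc using this
    refine hM.2.1 ⟨F ⊔ span (m '' s), ?_, ?_, ?_, ?_⟩
    · intro h
      exact hF (le_bot_iff.1 (h ▸ le_sup_left))
    · exact Submodule.FG.sup hfg (Submodule.fg_span (s.finite_toSet.image m))
    · refine sup_le hJ (span_le.2 ?_)
      rintro _ ⟨g, hg, rfl⟩
      exact hm g hg
    · intro a b hb hab
      refine g3 a b hb fun f hf => ?_
      have hby : b ∣ a * y := by
        rw [← algebraMap_div_mem_one_iff hb, map_mul, mul_comm, ← mul_div_assoc']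
        refine (FractionalIdeal.mem_inv_iff (I := (F : FractionalIdeal D⁰ (FractionRing D))⁻¹)
          (inv_ne_zero_of_ne_zero h0)).1 hx _ ?_
        rw [FractionalIdeal.mem_inv_iff h0]
        intro z hz
        obtain ⟨f, hf, rfl⟩ := (FractionalIdeal.mem_coeIdeal _).1 hz
        rw [div_mul_eq_mul_div, ← map_mul, algebraMap_div_mem_one_iff hb]
        exact hab f (le_sup_left (a := F) hf)
      induction hf using Submodule.span_induction with
      | mem g hg =>
        rw [← hc g hg, mul_add, mul_left_comm]
        exact dvd_add (hab _ (le_sup_right (a := F) (subset_span ⟨g, hg, rfl⟩)))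
          (hby.mul_left _)
      | zero => simp
      | add x y _ _ hx hy => rw [mul_add]; exact dvd_add hx hy
      | smul r x _ hx => rw [smul_eq_mul, mul_left_comm]; exact hx.mul_left _
  · intro x hx
    obtain ⟨y, hy, rfl⟩ := (FractionalIdeal.mem_coeIdeal _).1 hx
    by_cases h : y = 0
    -- Zero is treated apart: the principal ideal it generates is not an admissible `J`, so another
    -- nonzero element of `M` is used.
    · subst h
      obtain ⟨z, hz, hz0⟩ := Submodule.exists_mem_ne_zero_of_ne_bot hM.1
      have h0 : (span {z} : Ideal D) ≠ ⊥ := by simpa using hz0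
      refine ⟨(span {z} : Ideal D), FractionalIdeal.coeIdeal_ne_zero.2 h0, ?_, ?_, ?_⟩
      · rw [FractionalIdeal.coeIdeal_fg D⁰ (IsFractionRing.injective D (FractionRing D))]
        exact Submodule.fg_span (Set.finite_singleton z)
      · rwa [FractionalIdeal.coeIdeal_le_coeIdeal, span_singleton_le_iff_mem]
      · rw [map_zero]
        exact zero_mem (vClosure _).coeToSubmodule
    have h0 : (span {y} : Ideal D) ≠ ⊥ := by simpa using h
    refine ⟨(span {y} : Ideal D), FractionalIdeal.coeIdeal_ne_zero.2 h0, ?_, ?_, ?_⟩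
    · rw [FractionalIdeal.coeIdeal_fg D⁰ (IsFractionRing.injective D (FractionRing D))]
      exact Submodule.fg_span (Set.finite_singleton y)
    · rwa [FractionalIdeal.coeIdeal_le_coeIdeal, span_singleton_le_iff_mem]
    · exact le_vClosure (FractionalIdeal.coeIdeal_ne_zero.2 h0)
        (FractionalIdeal.mem_coeIdeal_of_mem _ (mem_span_singleton_self y))

lemma IsTIdeal.not_hasDenseFG {M : Ideal D} (hM : IsTIdeal M) (h : M ≠ ⊤) :
    ¬ M.HasDenseFG := by
  rw [← one_mem_tClosure_iff, hM.2]
  intro h1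
  obtain ⟨y, hy, hy1⟩ := (FractionalIdeal.mem_coeIdeal _).1 (SetLike.mem_coe.1 h1)
  rw [← map_one (algebraMap D _)] at hy1
  rw [IsFractionRing.injective D (FractionRing D) hy1] at hy
  exact h ((Ideal.eq_top_iff_one _).2 hy)

lemma isMaximalTIdeal_iff {M : Ideal D} : IsMaximalTIdeal M ↔ M.IsMaximalProperT := by
  constructor
  · rintro ⟨h1, h2, h3⟩
    obtain ⟨N, hMN, hN⟩ := Ideal.exists_le_isMaximalProperT h1.1 (h1.not_hasDenseFG h2)
    rwa [← h3 N hN.isTIdeal hN.isPrime.ne_top hMN]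
  · intro hM
    exact ⟨hM.isTIdeal, hM.isPrime.ne_top, fun N hN hN1 hMN =>
      hM.2.2 N hMN (hN.not_hasDenseFG hN1)⟩

/-- `D` is the intersection of its localizations at the maximal `t`-ideals. -/
lemma dvd_of_forall_isMaximalProperT {a b : D} (hb : b ≠ 0)
    (h : ∀ M : Ideal D, M.IsMaximalProperT → ∃ u ∉ M, b ∣ u * a) : b ∣ a := by
  by_contra hba
  -- The colon ideal `(b : a)`. If it contained a dense finitely generated ideal, then `b ∣ a`; so
  -- it lies in some maximal `t`-ideal.
  let C : Ideal D :=
    { carrier := {u | b ∣ u * a}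
      add_mem' := fun {x y} hx hy => by
        simp only [Set.mem_ofPred_eq, add_mul] at *
        exact dvd_add hx hy
      zero_mem' := by simp
      smul_mem' := fun c x hx => by
        simp only [Set.mem_ofPred_eq, smul_eq_mul, mul_assoc] at *
        exact hx.mul_left c }
  have hbC : b ∈ C := ⟨a, rfl⟩
  have hC0 : C ≠ ⊥ := by
    intro h
    rw [h] at hbC
    exact hb hbC
  obtain ⟨M, hCM, hM⟩ := Ideal.exists_le_isMaximalProperT hC0 (fun hd => hba
    (hd.invTrivial a b hb fun f hf => by rw [mul_comm]; exact hf))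
  obtain ⟨u, hu, hbu⟩ := h M hM
  exact hu (hCM hbu)

lemma isTInvertible_iff {I : FractionalIdeal D⁰ (FractionRing D)} (hI : I ≠ 0) :
    IsTInvertible I ↔
      ∃ A : Ideal D, A.HasDenseFG ∧ (A : FractionalIdeal D⁰ (FractionRing D)) = I * I⁻¹ := by
  obtain ⟨A, hA⟩ := FractionalIdeal.le_one_iff_exists_coeIdeal.1 (show I * I⁻¹ ≤ 1 by
    rw [FractionalIdeal.mul_le]
    intro i hi j hj
    rw [mul_comm]
    exact (FractionalIdeal.mem_inv_iff hI).1 hj i hi)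
  rw [IsTInvertible, ← hA, tClosure_eq_one_iff]
  constructor
  · exact fun h => ⟨A, h, rfl⟩
  · rintro ⟨B, hB, h⟩
    rwa [← FractionalIdeal.coeIdeal_injective h]

/-- A multiplier of a `t`-invertible fractional ideal lies in `D`. -/
lemma IsTInvertible.mem_one_of_mul_mem {I : FractionalIdeal D⁰ (FractionRing D)} (hI : I ≠ 0)
    (h : IsTInvertible I) {y : FractionRing D}
    (hy : ∀ i ∈ I, ∀ j ∈ I⁻¹, y * (i * j) ∈ (1 : FractionalIdeal D⁰ (FractionRing D))) :
    y ∈ (1 : FractionalIdeal D⁰ (FractionRing D)) := by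
  obtain ⟨A, hA, hAI⟩ := (isTInvertible_iff hI).1 h
  have hA0 : A ≠ ⊥ := by
    rintro rfl
    obtain ⟨F, h0, -, h1, -⟩ := hA
    exact h0 (le_bot_iff.1 h1)
  refine (inv_le_one_iff hA0).2 hA.invTrivial ?_
  rw [FractionalIdeal.mem_inv_iff (FractionalIdeal.coeIdeal_ne_zero.2 hA0), hAI]
  intro z hz
  refine FractionalIdeal.mul_induction_on (C := fun z => y * z ∈ (1 : FractionalIdeal _ _))
    hz hy fun x z hx hz => ?_
  rw [mul_add]
  exact add_mem (S := Submodule D (FractionRing D)) hx hz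

/-- Locally at a maximal `t`-ideal, a `t`-invertible fractional ideal is invertible. -/
lemma IsTInvertible.exists_mul_notMem {I : FractionalIdeal D⁰ (FractionRing D)} (hI : I ≠ 0)
    (h : IsTInvertible I) {M : Ideal D} (hM : ¬ M.HasDenseFG) :
    ∃ i ∈ I, ∃ j ∈ I⁻¹, i * j ∉ (M : FractionalIdeal D⁰ (FractionRing D)) := by
  by_contra! hcon
  obtain ⟨A, hA, hAI⟩ := (isTInvertible_iff hI).1 h
  refine hM (hA.mono ?_)
  rw [← FractionalIdeal.coeIdeal_le_coeIdeal (FractionRing D), hAI, FractionalIdeal.mul_le]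
  exact hcon

/-- With `A = I I⁻¹`, `xA ⊆ D` gives `x I⁻¹ ⊆ I⁻¹`, hence `x ^ n I⁻¹ ⊆ I⁻¹` and `z x ^ n ∈ D` for `z
∈ A`. Complete integral closure yields `A⁻¹ = D`, and the H-property finishes. -/
lemma isTInvertible_of_isHDomain (hc : IsCompletelyIntegrallyClosed D) (hH : IsHDomain D)
    {I : FractionalIdeal D⁰ (FractionRing D)} (hI : I ≠ 0) : IsTInvertible I := by
  rw [isTInvertible_iff hI]
  obtain ⟨A, hA⟩ := FractionalIdeal.le_one_iff_exists_coeIdeal.1 (show I * I⁻¹ ≤ 1 by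
    rw [FractionalIdeal.mul_le]
    intro i hi j hj
    rw [mul_comm]
    exact (FractionalIdeal.mem_inv_iff hI).1 hj i hi)
  have hA0 : A ≠ ⊥ := by
    rw [← FractionalIdeal.coeIdeal_ne_zero (K := FractionRing D), hA, ← FractionalIdeal.bot_eq_zero]
    exact (FractionalIdeal.bot_lt_mul_inv hI).ne'
  refine ⟨A, isHDomain_iff.1 hH A hA0 ((inv_le_one_iff hA0).1 ?_), hA⟩
  intro x hx
  rw [FractionalIdeal.mem_inv_iff (FractionalIdeal.coeIdeal_ne_zero.2 hA0), hA] at hx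
  have hxI : ∀ j ∈ I⁻¹, x * j ∈ I⁻¹ := by
    intro j hj
    rw [FractionalIdeal.mem_inv_iff hI]
    intro i hi
    rw [mul_assoc, mul_comm j]
    exact hx _ (FractionalIdeal.mul_mem_mul hi hj)
  have hpow : ∀ n : ℕ, ∀ j ∈ I⁻¹, x ^ n * j ∈ I⁻¹ := by
    intro n
    induction n with
    | zero => simp
    | succ n ih =>
      intro j hj
      rw [pow_succ, mul_assoc]
      exact ih _ (hxI j hj)
  obtain ⟨z, hz, hz0⟩ := Submodule.exists_mem_ne_zero_of_ne_bot hA0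
  rw [FractionalIdeal.mem_one_iff]
  refine hc x ⟨z, mem_nonZeroDivisors_of_ne_zero hz0, fun n => ?_⟩
  have hzA : algebraMap D (FractionRing D) z ∈ I * I⁻¹ :=
    hA ▸ FractionalIdeal.mem_coeIdeal_of_mem _ hz
  change z • x ^ n ∈ Set.range (algebraMap D (FractionRing D))
  rw [Algebra.smul_def, Set.mem_range, ← FractionalIdeal.mem_one_iff D⁰]
  refine FractionalIdeal.mul_induction_on (C := fun z => z * x ^ n ∈ (1 : FractionalIdeal _ _))
    hzA (fun i hi j hj => ?_) fun y z hy hz => ?_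
  · rw [mul_comm, mul_comm i, ← mul_assoc]
    exact (FractionalIdeal.mem_inv_iff hI).1 (hpow n j hj) i hi
  · rw [add_mul]
    exact add_mem (S := Submodule D (FractionRing D)) hy hz

lemma isPVMD_of_isHDomain (hc : IsCompletelyIntegrallyClosed D) (hH : IsHDomain D) :
    IsPVMD D :=
  fun _ hI _ => isTInvertible_of_isHDomain hc hH hI

end TOperation

/-! ### Discrete rank-one localizations at maximal `t`-ideals -/

section Uniformizers

variable {D : Type*} [CommRing D] [IsDomain D]

namespace Ideal

/-- `m` is a uniformizer of a discrete rank-one valuation on the localization of `D` at `M`. -/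
def IsUniformizerAt (M : Ideal D) (m : D) : Prop :=
  m ∈ M ∧ m ≠ 0 ∧ ∀ c : D, c ≠ 0 → ∃ n : ℕ, ∃ u ∉ M, ∃ w ∉ M, u * c = m ^ n * w

/-- The exponent of `c` is the last `n` for which `m ^ n` divides `c` locally; the cofactor is then
outside `M`, since otherwise another `m` could be split off. -/
lemma isUniformizerAt_of_forall_exists {M : Ideal D} (hM : M.IsPrime) (h0 : M ≠ ⊥) {m : D}
    (hm : m ∈ M) (h1 : ∀ y ∈ M, ∃ u ∉ M, m ∣ u * y)
    (h2 : ∀ c : D, (∀ n : ℕ, ∃ u ∉ M, m ^ n ∣ u * c) → c = 0) : M.IsUniformizerAt m := by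
  have hm0 : m ≠ 0 := by
    rintro rfl
    obtain ⟨z, hz, hz0⟩ := Submodule.exists_mem_ne_zero_of_ne_bot h0
    obtain ⟨u, hu, hd⟩ := h1 z hz
    rcases mul_eq_zero.1 (zero_dvd_iff.1 hd) with h | h
    · exact hu (h ▸ M.zero_mem)
    · exact hz0 h
  refine ⟨hm, hm0, fun c hc => ?_⟩
  have hex : ∃ n : ℕ, ¬ ∃ u ∉ M, m ^ n ∣ u * c := by
    by_contra! hcon
    exact hc (h2 c hcon)
  classical
  obtain ⟨k, hk⟩ : ∃ k, Nat.find hex = k + 1 := by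
    refine Nat.exists_eq_succ_of_ne_zero fun h => ?_
    have := Nat.find_spec hex
    rw [h] at this
    exact this ⟨1, fun h => hM.ne_top ((eq_top_iff_one _).2 h), by simp⟩
  obtain ⟨u, hu, w, hw⟩ := not_not.1 (Nat.find_min hex (m := k) (by omega))
  refine ⟨k, u, hu, w, fun hwM => ?_, hw⟩
  obtain ⟨v, hv, hd⟩ := h1 w hwM
  have := Nat.find_spec hex
  rw [hk] at this
  refine this ⟨v * u, hM.mul_notMem hv hu, ?_⟩
  rw [mul_assoc, hw, mul_left_comm, pow_succ]
  exact mul_dvd_mul_left _ hd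

lemma IsUniformizerAt.dvd_or_dvd {M : Ideal D} [hM : M.IsPrime] {m : D}
    (h : M.IsUniformizerAt m) (a b : D) :
    (∃ u ∉ M, b ∣ u * a) ∨ (∃ u ∉ M, a ∣ u * b) := by
  have h1 : (1 : D) ∉ M := fun h => hM.ne_top ((eq_top_iff_one _).2 h)
  by_cases ha : a = 0
  · exact Or.inl ⟨1, h1, by simp [ha]⟩
  by_cases hb : b = 0
  · exact Or.inr ⟨1, h1, by simp [hb]⟩
  obtain ⟨i, u, hu, w, hw, hi⟩ := h.2.2 a ha
  obtain ⟨j, v, hv, z, hz, hj⟩ := h.2.2 b hb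
  rcases le_total j i with hij | hij
  · obtain ⟨k, rfl⟩ := Nat.exists_eq_add_of_le hij
    refine Or.inl ⟨z * u, hM.mul_notMem hz hu, v * m ^ k * w, ?_⟩
    linear_combination z * hi - m ^ k * w * hj
  · obtain ⟨k, rfl⟩ := Nat.exists_eq_add_of_le hij
    refine Or.inr ⟨w * v, hM.mul_notMem hw hv, u * m ^ k * z, ?_⟩
    linear_combination w * hj - m ^ k * z * hi

lemma IsUniformizerAt.exists_dvd_mul_pow {M : Ideal D} [hM : M.IsPrime] {m : D}
    (h : M.IsUniformizerAt m) {d y : D} (hd : d ≠ 0) (hy : y ∈ M) :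
    ∃ n : ℕ, ∃ u ∉ M, d ∣ u * y ^ n := by
  by_cases hy0 : y = 0
  · exact ⟨1, 1, fun h => hM.ne_top ((eq_top_iff_one _).2 h), by simp [hy0]⟩
  obtain ⟨i, u, hu, w, hw, hi⟩ := h.2.2 d hd
  obtain ⟨j, v, hv, z, hz, hj⟩ := h.2.2 y hy0
  have hj0 : j ≠ 0 := by
    rintro rfl
    have : u * y ∈ M := M.mul_mem_left _ hy
    rw [pow_zero, one_mul] at hj
    exact hz (hj ▸ M.mul_mem_left _ hy)
  refine ⟨i, w * v ^ i, hM.mul_notMem hw fun h => hv (hM.mem_of_pow_mem _ h), ?_⟩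
  obtain ⟨k, rfl⟩ := Nat.exists_eq_succ_of_ne_zero hj0
  refine ⟨u * m ^ (k * i) * z ^ i, ?_⟩
  have : v ^ i * y ^ i = m ^ i * m ^ (k * i) * z ^ i := by
    rw [← mul_pow, hj, Nat.succ_eq_add_one]
    ring
  linear_combination w * this - m ^ (k * i) * z ^ i * hi

/-- A ring satisfying the characterization of the localization at `M` is a discrete valuation
ring. -/
lemma IsUniformizerAt.isDiscreteValuationRing {M : Ideal D} {m : D} (h : M.IsUniformizerAt m)
    {A : Type*} [CommRing A] [IsDomain A] (φ : D →+* A) (hφ : Function.Injective φ)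
    (hu : ∀ u ∉ M, IsUnit (φ u)) (hs : ∀ x : A, ∃ a : D, ∃ u ∉ M, x * φ u = φ a)
    (hm : ¬ IsUnit (φ m)) : IsDiscreteValuationRing A := by
  have key : ∀ x : A, x ≠ 0 → ∃ n : ℕ, Associated (φ m ^ n) x := by
    intro x hx
    obtain ⟨a, u, hu', hxa⟩ := hs x
    have ha : a ≠ 0 := by
      rintro rfl
      rw [map_zero] at hxa
      exact mul_ne_zero hx (hu u hu').ne_zero hxa
    obtain ⟨n, v, hv, w, hw, hn⟩ := h.2.2 a ha
    refine ⟨n, ?_⟩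
    have e1 : Associated (φ m ^ n) (φ m ^ n * φ w) :=
      (associated_mul_unit_right _ _ (hu w hw))
    have e2 : Associated x (x * (φ v * φ u)) :=
      associated_mul_unit_right _ _ ((hu v hv).mul (hu u hu'))
    have e3 : x * (φ v * φ u) = φ m ^ n * φ w := by
      rw [← map_pow, ← map_mul _ (m ^ n), ← hn, map_mul, ← hxa]
      ring
    rw [e3] at e2
    exact e1.trans e2.symm
  have hm0 : φ m ≠ 0 := by
    rw [Ne, map_eq_zero_iff φ hφ]
    exact h.2.1
  refine IsDiscreteValuationRing.ofHasUnitMulPowIrreducibleFactorization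
    ⟨φ m, ⟨hm, fun {a b} hab => ?_⟩, fun {x} hx => key x hx⟩
  obtain ⟨i, hi⟩ := key a (by rintro rfl; simp [hm0] at hab)
  obtain ⟨j, hj⟩ := key b (by rintro rfl; simp [hm0] at hab)
  have hij : Associated (φ m ^ (i + j)) (φ m ^ 1) := by
    rw [pow_add, pow_one, hab, ← hab]
    exact hab ▸ hi.mul_mul hj
  have hij : φ m ^ (i + j) ∣ φ m ^ 1 := hij.dvd
  rw [pow_dvd_pow_iff hm0 hm] at hij
  rcases Nat.eq_zero_or_pos i with rfl | hi0
  · exact Or.inl (hi.isUnit (by simp))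
  · obtain rfl : j = 0 := by omega
    exact Or.inr (hj.isUnit (by simp))

/-- The localization of `D` at `M`, as a valuation subring of the quotient field. -/
def IsUniformizerAt.valuationSubring {M : Ideal D} [hM : M.IsPrime] {m : D}
    (h : M.IsUniformizerAt m) : ValuationSubring (FractionRing D) where
  carrier := {x | ∃ a : D, ∃ u ∉ M, x * algebraMap D _ u = algebraMap D _ a}
  mul_mem' := by
    rintro x y ⟨a, u, hu, hx⟩ ⟨b, v, hv, hy⟩
    refine ⟨a * b, u * v, hM.mul_notMem hu hv, ?_⟩
    rw [map_mul, map_mul, ← hx, ← hy]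
    ring
  one_mem' := ⟨1, 1, fun h => hM.ne_top ((eq_top_iff_one _).2 h), by simp⟩
  add_mem' := by
    rintro x y ⟨a, u, hu, hx⟩ ⟨b, v, hv, hy⟩
    refine ⟨a * v + b * u, u * v, hM.mul_notMem hu hv, ?_⟩
    rw [map_mul, map_add, map_mul, map_mul, ← hx, ← hy]
    ring
  zero_mem' := ⟨0, 1, fun h => hM.ne_top ((eq_top_iff_one _).2 h), by simp⟩
  neg_mem' := by
    rintro x ⟨a, u, hu, hx⟩
    exact ⟨-a, u, hu, by rw [map_neg, ← hx, neg_mul]⟩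
  mem_or_inv_mem' := by
    intro x
    obtain ⟨a, b, hb, rfl⟩ := IsFractionRing.div_surjective (A := D) x
    have hb : algebraMap D (FractionRing D) b ≠ 0 := by
      simpa using nonZeroDivisors.ne_zero hb
    rcases h.dvd_or_dvd a b with ⟨u, hu, c, hc⟩ | ⟨u, hu, c, hc⟩
    · refine Or.inl ⟨c, u, hu, ?_⟩
      rw [div_mul_eq_mul_div, div_eq_iff hb, ← map_mul, ← map_mul, mul_comm, hc, mul_comm]
    · rw [inv_div]
      by_cases ha : algebraMap D (FractionRing D) a = 0
      · exact Or.inr ⟨0, u, hu, by simp [ha]⟩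
      refine Or.inr ⟨c, u, hu, ?_⟩
      rw [div_mul_eq_mul_div, div_eq_iff ha, ← map_mul, ← map_mul, mul_comm, hc, mul_comm]

lemma IsUniformizerAt.algebraMap_mem {M : Ideal D} [hM : M.IsPrime] {m : D}
    (h : M.IsUniformizerAt m) (a : D) : algebraMap D (FractionRing D) a ∈ h.valuationSubring :=
  ⟨a, 1, fun h => hM.ne_top ((eq_top_iff_one _).2 h), by simp⟩

lemma IsUniformizerAt.inv_mem {M : Ideal D} [hM : M.IsPrime] {m : D}
    (h : M.IsUniformizerAt m) {a : D} (ha : a ∉ M) :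
    (algebraMap D (FractionRing D) a)⁻¹ ∈ h.valuationSubring := by
  refine ⟨1, a, ha, ?_⟩
  rw [map_one, inv_mul_cancel₀]
  rw [Ne, map_eq_zero_iff _ (IsFractionRing.injective D (FractionRing D))]
  rintro rfl
  exact ha M.zero_mem

lemma IsUniformizerAt.isDiscreteValuationRing_valuationSubring {M : Ideal D} [hM : M.IsPrime]
    {m : D} (h : M.IsUniformizerAt m) : IsDiscreteValuationRing h.valuationSubring := by
  have hinj := IsFractionRing.injective D (FractionRing D)
  have hne : ∀ u ∉ M, algebraMap D (FractionRing D) u ≠ 0 := by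
    intro u hu h
    rw [map_eq_zero_iff _ hinj] at h
    exact hu (h ▸ M.zero_mem)
  refine h.isDiscreteValuationRing
    ((algebraMap D (FractionRing D)).codRestrict h.valuationSubring.toSubring h.algebraMap_mem)
    ?_ ?_ ?_ ?_
  · intro a b hab
    exact hinj (congrArg Subtype.val hab)
  · intro u hu
    exact IsUnit.of_mul_eq_one ⟨_, h.inv_mem hu⟩ (Subtype.ext (mul_inv_cancel₀ (hne u hu)))
  · rintro ⟨x, a, u, hu, hx⟩
    exact ⟨a, u, hu, Subtype.ext hx⟩
  · intro hunit
    obtain ⟨⟨x, a, u, hu, hx⟩, hy⟩ := hunit.exists_right_inv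
    have hy : algebraMap D (FractionRing D) m * x = 1 := congrArg Subtype.val hy
    have : m * a = u := by
      apply hinj
      rw [map_mul, ← hx, ← mul_assoc, hy, one_mul]
    exact hu (this ▸ M.mul_mem_right _ h.1)

lemma IsUniformizerAt.isDiscreteValuationRing_localization {M : Ideal D} [hM : M.IsPrime]
    {m : D} (h : M.IsUniformizerAt m) : IsDiscreteValuationRing (Localization.AtPrime M) := by
  refine h.isDiscreteValuationRing (algebraMap D _)
    (IsLocalization.injective _ M.primeCompl_le_nonZeroDivisors) ?_ ?_ ?_
  · exact fun u hu => IsLocalization.map_units _ (⟨u, hu⟩ : M.primeCompl)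
  · intro x
    obtain ⟨⟨a, u⟩, hx⟩ := IsLocalization.surj M.primeCompl x
    exact ⟨a, u, u.2, hx⟩
  · rw [IsLocalization.AtPrime.isUnit_to_map_iff _ M]
    exact fun hm => hm h.1

end Ideal

lemma isKrullDomain_of_isUniformizerAt
    (h1 : ∀ M : Ideal D, M.IsMaximalProperT → ∃ m, M.IsUniformizerAt m)
    (h2 : ∀ d : D, d ≠ 0 → {M : Ideal D | M.IsMaximalProperT ∧ d ∈ M}.Finite) :
    IsKrullDomain D := by
  choose m hm using h1
  have hpr (M : {M : Ideal D // M.IsMaximalProperT}) : M.1.IsPrime := M.2.isPrime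
  let V (M : {M : Ideal D // M.IsMaximalProperT}) : ValuationSubring (FractionRing D) :=
    (hm M.1 M.2).valuationSubring
  refine ⟨Set.range V, ?_, fun x => ⟨?_, fun hx => ?_⟩, fun d hd => ?_⟩
  · rintro _ ⟨M, rfl⟩
    exact (hm M.1 M.2).isDiscreteValuationRing_valuationSubring
  · rintro ⟨a, rfl⟩ _ ⟨M, rfl⟩
    exact (hm M.1 M.2).algebraMap_mem a
  · obtain ⟨a, b, hb, rfl⟩ := IsFractionRing.div_surjective (A := D) x
    have hb := nonZeroDivisors.ne_zero hb
    have hb' : algebraMap D (FractionRing D) b ≠ 0 := by simpa using hb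
    suffices h : b ∣ a by
      obtain ⟨c, rfl⟩ := h
      exact ⟨c, by rw [map_mul, mul_div_cancel_left₀ _ hb']⟩
    refine dvd_of_forall_isMaximalProperT hb fun M hM => ?_
    obtain ⟨c, u, hu, hx⟩ := hx _ ⟨⟨M, hM⟩, rfl⟩
    refine ⟨u, hu, c, ?_⟩
    rw [div_mul_eq_mul_div, div_eq_iff hb', ← map_mul, ← map_mul] at hx
    rw [mul_comm, IsFractionRing.injective D (FractionRing D) hx, mul_comm]
  · have hfin : {M : {M : Ideal D // M.IsMaximalProperT} | d ∈ M.1}.Finite := by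
      refine Set.Finite.of_finite_image ((h2 d hd).subset ?_) Subtype.val_injective.injOn
      rintro _ ⟨M, hM, rfl⟩
      exact ⟨M.2, hM⟩
    refine (hfin.image V).subset ?_
    rintro _ ⟨⟨M, rfl⟩, hM⟩
    refine ⟨M, ?_, rfl⟩
    by_contra hd
    exact hM ((hm M.1 M.2).inv_mem hd)

lemma isKrullLikePVMD_of_isUniformizerAt (h0 : IsPVMD D)
    (h1 : ∀ M : Ideal D, M.IsMaximalProperT → ∃ m, M.IsUniformizerAt m)
    (h2 : ∀ d : D, d ≠ 0 → {M : Ideal D | M.IsMaximalProperT ∧ d ∈ M}.Finite) :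
    IsKrullLikePVMD D := by
  refine ⟨h0, fun M _ hM => ?_, fun a => ?_⟩
  · obtain ⟨m, hm⟩ := h1 M (isMaximalTIdeal_iff.1 hM)
    have := hm.isDiscreteValuationRing_localization
    refine ⟨inferInstance, inferInstance, fun P hP hP0 h => ?_⟩
    have h' : IsIdempotentElem P := by rw [IsIdempotentElem, ← pow_two, ← h]
    rcases (Ideal.isIdempotentElem_iff_eq_bot_or_top P (Ideal.fg_of_isNoetherianRing P)).1 h' with
      h | h
    · exact hP0 h
    · exact hP.ne_top h
  · by_cases ha : a = 0
    · subst ha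
      refine (Set.finite_singleton (⊥ : Ideal D)).subset fun P hP => ?_
      exact le_bot_iff.1 (hP.2 ⟨Ideal.isPrime_bot, by simp⟩ bot_le)
    · refine (h2 a ha).subset fun P hP => ?_
      have hPp : P.IsPrime := hP.1.1
      have haP : a ∈ P := (Ideal.span_singleton_le_iff_mem _).1 hP.1.2
      suffices h : ∃ M : Ideal D, M.IsMaximalProperT ∧ a ∈ M ∧ M ≤ P by
        obtain ⟨M, hM, haM, hMP⟩ := h
        have := hP.2 ⟨hM.isPrime, (Ideal.span_singleton_le_iff_mem _).2 haM⟩ hMP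
        rw [le_antisymm this hMP]
        exact ⟨hM, haM⟩
      -- If `P` contains no maximal `t`-ideal through `a`, each such `M` has an element outside `P`
      -- that `a` divides locally at `M`. Their finite product is divisible by `a` at every maximal
      -- `t`-ideal, hence in `D`, which puts it in `P`.
      by_contra! hcon
      have : ∀ M : Ideal D, M.IsMaximalProperT ∧ a ∈ M →
          ∃ y ∉ P, ∃ u ∉ M, a ∣ u * y := by
        rintro M ⟨hM, haM⟩
        obtain ⟨y, hyM, hyP⟩ := SetLike.not_le_iff_exists.1 (hcon M hM haM)
        have := hM.isPrime
        obtain ⟨m, hm⟩ := h1 M hM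
        obtain ⟨n, u, hu, hd⟩ := hm.exists_dvd_mul_pow ha hyM
        exact ⟨y ^ n, fun h => hyP (hPp.mem_of_pow_mem _ h), u, hu, hd⟩
      choose! y hyP u hu hd using this
      have hprod : ∏ M ∈ (h2 a ha).toFinset, y M ∉ P := by
        rw [Ideal.IsPrime.prod_mem_iff]
        push Not
        intro M hM
        exact hyP M ((h2 a ha).mem_toFinset.1 hM)
      refine hprod (P.mem_of_dvd (dvd_of_forall_isMaximalProperT ha fun M hM => ?_) haP)
      by_cases haM : a ∈ M
      · exact ⟨u M, hu M ⟨hM, haM⟩, (hd M ⟨hM, haM⟩).trans (mul_dvd_mul_left _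
          (Finset.dvd_prod_of_mem y ((h2 a ha).mem_toFinset.2 ⟨hM, haM⟩)))⟩
      · exact ⟨a, haM, dvd_mul_right _ _⟩

/-! ### Completely integrally closed H-domains are Krull -/

section HDomain

/-- In a completely integrally closed H-domain the maximal `t`-ideals are `t`-invertible. -/
lemma Ideal.IsMaximalProperT.exists_inv (hc : IsCompletelyIntegrallyClosed D) (hH : IsHDomain D)
    {M : Ideal D} (hM : M.IsMaximalProperT) :
    ∃ s : FractionRing D, (∀ y ∈ M, ∃ t : D, algebraMap D _ t = s * algebraMap D _ y) ∧
      ∃ m ∈ M, ∃ u ∉ M, algebraMap D _ u = s * algebraMap D _ m := by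
  have h0 := (FractionalIdeal.coeIdeal_ne_zero (K := FractionRing D)).2 hM.1
  obtain ⟨i, hi, s, hs, his⟩ :=
    (isTInvertible_of_isHDomain hc hH h0).exists_mul_notMem h0 hM.2.1
  have hsM : ∀ y ∈ M, ∃ t : D, algebraMap D _ t = s * algebraMap D _ y := fun y hy =>
    (FractionalIdeal.mem_one_iff _).1 ((FractionalIdeal.mem_inv_iff h0).1 hs _
      (FractionalIdeal.mem_coeIdeal_of_mem _ hy))
  obtain ⟨m, hm, rfl⟩ := (FractionalIdeal.mem_coeIdeal _).1 hi
  obtain ⟨u, hu⟩ := hsM m hm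
  refine ⟨s, hsM, m, hm, u, fun huM => his ?_, hu⟩
  rw [mul_comm, ← hu]
  exact FractionalIdeal.mem_coeIdeal_of_mem _ huM

/-- Powers of `s` are applied one at a time. While `k < N`, the element `t = s ^ k c` still has a
factor `m` locally, because `m ^ k t = u ^ k c`; so `t ∈ M`, and `s t ∈ D`. -/
lemma exists_mul_inv_pow {M : Ideal D} (hM : M.IsPrime) {s : FractionRing D}
    (hs : ∀ y ∈ M, ∃ t : D, algebraMap D _ t = s * algebraMap D _ y) {m u : D} (hm : m ∈ M)
    (hm0 : m ≠ 0) (hu : algebraMap D _ u = s * algebraMap D _ m) {c : D} {N : ℕ}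
    (hc : ∃ v ∉ M, m ^ N ∣ v * c) :
    ∃ t : D, algebraMap D _ t = s ^ N * algebraMap D _ c := by
  obtain ⟨v, hv, d, hd⟩ := hc
  have : ∀ k ≤ N, ∃ t : D, algebraMap D _ t = s ^ k * algebraMap D _ c := by
    intro k
    induction k with
    | zero => exact fun _ => ⟨c, by simp⟩
    | succ k ih =>
      intro hk
      obtain ⟨t, ht⟩ := ih (by omega)
      have h1 : m ^ k * t = u ^ k * c := by
        apply IsFractionRing.injective D (FractionRing D)
        rw [map_mul, map_mul, map_pow, map_pow, ht, hu]
        ring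
      have htM : t ∈ M := by
        obtain ⟨l, rfl⟩ := Nat.exists_eq_add_of_le hk
        have : v * t = m * (u ^ k * m ^ l * d) := by
          apply mul_left_cancel₀ (pow_ne_zero k hm0)
          rw [mul_left_comm, h1, mul_left_comm, hd]
          ring
        exact (hM.mem_or_mem (this ▸ M.mul_mem_right _ hm)).resolve_left hv
      obtain ⟨r, hr⟩ := hs t htM
      exact ⟨r, by rw [hr, ht, pow_succ]; ring⟩
  exact this N le_rfl

/-- A nonzero `c` in every `m ^ n D_M` would give `s ^ n c ∈ D` for all `n`, making `s` almost
integral. Then `s ∈ D` and `u = s m ∈ M`. -/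
lemma Ideal.IsMaximalProperT.isUniformizerAt_of_inv (hcic : IsCompletelyIntegrallyClosed D)
    {M : Ideal D} (hM : M.IsMaximalProperT) {s : FractionRing D}
    (hs : ∀ y ∈ M, ∃ t : D, algebraMap D _ t = s * algebraMap D _ y) {m u : D} (hm : m ∈ M)
    (huM : u ∉ M) (hu : algebraMap D _ u = s * algebraMap D _ m) : M.IsUniformizerAt m := by
  have hinj := IsFractionRing.injective D (FractionRing D)
  have hm0 : m ≠ 0 := by
    rintro rfl
    rw [map_zero, mul_zero, map_eq_zero_iff _ hinj] at hu
    exact huM (hu ▸ M.zero_mem)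
  refine isUniformizerAt_of_forall_exists hM.isPrime hM.1 hm (fun y hy => ?_) fun c hc => ?_
  · obtain ⟨t, ht⟩ := hs y hy
    refine ⟨u, huM, t, hinj ?_⟩
    rw [map_mul, map_mul, hu, ht]
    ring
  · by_contra hc0
    obtain ⟨a, rfl⟩ := hcic s ⟨c, mem_nonZeroDivisors_of_ne_zero hc0, fun n => by
      obtain ⟨t, ht⟩ := exists_mul_inv_pow hM.isPrime hs hm hm0 hu (hc n)
      exact ⟨t, by rw [ht, Algebra.smul_def, mul_comm]⟩⟩
    rw [← map_mul] at hu
    exact huM (hinj hu ▸ M.mul_mem_left _ hm)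

lemma Ideal.IsMaximalProperT.exists_isUniformizerAt (hc : IsCompletelyIntegrallyClosed D)
    (hH : IsHDomain D) {M : Ideal D} (hM : M.IsMaximalProperT) : ∃ m, M.IsUniformizerAt m := by
  obtain ⟨s, hs, m, hm, u, huM, hu⟩ := hM.exists_inv hc hH
  exact ⟨m, hM.isUniformizerAt_of_inv hc hs hm huM hu⟩

/-- For each `M` through `d`, stripping the `M`-part gives `g_M = s ^ e d`, outside `M` but in all
other maximal `t`-ideals through `d`. No maximal `t`-ideal contains `d` and all `g_M`, so finitely
many of them together with `d` already generate an ideal with `t`-closure `D`. An `M` outside that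
finite list would contain all these generators. -/
lemma finite_isMaximalProperT (hc : IsCompletelyIntegrallyClosed D)
    (hH : IsHDomain D) {d : D} (hd : d ≠ 0) :
    {M : Ideal D | M.IsMaximalProperT ∧ d ∈ M}.Finite := by
  have hinj := IsFractionRing.injective D (FractionRing D)
  have key : ∀ M : Ideal D, M.IsMaximalProperT ∧ d ∈ M → ∃ g : D, g ∉ M ∧
      ∀ N : Ideal D, N.IsMaximalProperT ∧ d ∈ N → N ≠ M → g ∈ N := by
    rintro M ⟨hM, hdM⟩
    obtain ⟨s, hs, m, hm, u, huM, hu⟩ := hM.exists_inv hc hH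
    have hU := hM.isUniformizerAt_of_inv hc hs hm huM hu
    obtain ⟨e, v, hv, w, hw, he⟩ := hU.2.2 d hd
    obtain ⟨g, hg⟩ := exists_mul_inv_pow hM.isPrime hs hm hU.2.1 hu
      ⟨v, hv, (he ▸ dvd_mul_right _ _ : m ^ e ∣ v * d)⟩
    refine ⟨g, fun hgM => ?_, ?_⟩
    · have : v * g = u ^ e * w := by
        apply mul_left_cancel₀ (pow_ne_zero e hU.2.1)
        apply hinj
        have := congrArg (algebraMap D (FractionRing D)) he
        simp only [map_mul, map_pow, hg, hu] at this ⊢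
        linear_combination s ^ e * algebraMap D (FractionRing D) m ^ e * this
      have h2 : u ^ e * w ∈ M := this ▸ M.mul_mem_left _ hgM
      exact (hM.isPrime.mem_or_mem h2).elim (fun h => huM (hM.isPrime.mem_of_pow_mem _ h)) hw
    · rintro N ⟨hN, hdN⟩ hNM
      obtain ⟨f, hfM, hfN⟩ := SetLike.not_le_iff_exists.1
        (fun h : M ≤ N => hNM (hM.2.2 N h hN.2.1))
      obtain ⟨t, ht⟩ := hs f hfM
      have : f ^ e * g = t ^ e * d := by
        apply hinj
        simp only [map_mul, map_pow, hg, ht]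
        ring
      have h2 : f ^ e * g ∈ N := this ▸ N.mul_mem_left _ hdN
      exact (hN.isPrime.mem_or_mem h2).resolve_left fun h => hfN (hN.isPrime.mem_of_pow_mem _ h)
  choose! g hgM hgN using key
  set S := {M : Ideal D | M.IsMaximalProperT ∧ d ∈ M} with hS
  have hA : (Ideal.span (insert d (g '' S))).HasDenseFG := by
    by_contra hA
    have hdA : d ∈ Ideal.span (insert d (g '' S)) := Ideal.subset_span (Set.mem_insert _ _)
    obtain ⟨M, hAM, hM⟩ := Ideal.exists_le_isMaximalProperT (by
      intro h
      rw [h] at hdA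
      exact hd hdA) hA
    have hMS : M ∈ S := ⟨hM, hAM hdA⟩
    exact hgM M hMS (hAM (Ideal.subset_span (Or.inr ⟨M, hMS, rfl⟩)))
  obtain ⟨F, hF0, ⟨σ, rfl⟩, hFA, hF⟩ := hA
  have hT : ∃ T : Finset (Ideal D), (T : Set (Ideal D)) ⊆ S ∧
      Ideal.span (σ : Set D) ≤ Ideal.span (insert d (g '' (T : Set (Ideal D)))) := by
    classical
    obtain ⟨τ, hτ, hστ⟩ := Submodule.subset_span_finite_of_subset_span (Ideal.span_le.1 hFA)
    have h : ((τ.erase d : Finset D) : Set D) ⊆ g '' S := by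
      intro x hx
      rw [Finset.mem_coe, Finset.mem_erase] at hx
      exact (hτ hx.2).resolve_left hx.1
    obtain ⟨T, hTS, hT⟩ := Finset.subset_set_image_iff.1 h
    refine ⟨T, hTS, Ideal.span_le.2 (hστ.trans (Ideal.span_mono fun x hx => ?_))⟩
    by_cases hxd : x = d
    · exact Or.inl hxd
    · rw [← Finset.coe_image, hT]
      exact Or.inr (Finset.mem_erase.2 ⟨hxd, hx⟩)
  obtain ⟨T, hTS, hT⟩ := hT
  refine T.finite_toSet.subset fun N hN => ?_
  by_contra hNT
  refine hN.1.2.1 ⟨_, hF0, ⟨σ, rfl⟩, hT.trans (Ideal.span_le.2 ?_), hF⟩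
  rintro x (rfl | ⟨M, hM, rfl⟩)
  · exact hN.2
  · exact hgN M (hTS hM) N hN (fun h => hNT (h ▸ hM))

end HDomain

lemma isKrullDomain_of_isHDomain (hc : IsCompletelyIntegrallyClosed D) (hH : IsHDomain D) :
    IsKrullDomain D :=
  isKrullDomain_of_isUniformizerAt (fun _ hM => hM.exists_isUniformizerAt hc hH)
    fun _ hd => finite_isMaximalProperT hc hH hd

lemma isKrullLikePVMD_of_isHDomain (hc : IsCompletelyIntegrallyClosed D) (hH : IsHDomain D) :
    IsKrullLikePVMD D :=
  isKrullLikePVMD_of_isUniformizerAt (isPVMD_of_isHDomain hc hH)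
    (fun _ hM => hM.exists_isUniformizerAt hc hH) fun _ hd => finite_isMaximalProperT hc hH hd

end Uniformizers

/-! ### Complete integral closure of Krull domains and of power series rings -/

section CompleteIntegralClosure

lemma isCompletelyIntegrallyClosed_iff {D : Type*} [CommRing D] [IsDomain D] :
    IsCompletelyIntegrallyClosed D ↔
      ∀ r g h : D, r ≠ 0 → h ≠ 0 → (∀ n : ℕ, h ^ n ∣ r * g ^ n) → h ∣ g := by
  have key (r g h : D) (hh : h ≠ 0) (n : ℕ) : h ^ n ∣ r * g ^ n ↔
      r • (algebraMap D (FractionRing D) g / algebraMap D (FractionRing D) h) ^ n ∈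
        (algebraMap D (FractionRing D)).range := by
    rw [← algebraMap_div_mem_one_iff (pow_ne_zero n hh), FractionalIdeal.mem_one_iff,
      RingHom.mem_range, Algebra.smul_def, map_mul, map_pow, map_pow, div_pow, mul_div_assoc]
  constructor
  · intro hD r g h hr hh H
    obtain ⟨c, hc⟩ := hD _ ⟨r, mem_nonZeroDivisors_of_ne_zero hr, fun n => (key r g h hh n).1 (H n)⟩
    exact (algebraMap_div_mem_one_iff hh).1 ((FractionalIdeal.mem_one_iff _).2 ⟨c, hc⟩)
  · rintro hD x ⟨r, hr, H⟩
    obtain ⟨g, h, hh, rfl⟩ := IsFractionRing.div_surjective (A := D) x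
    have hh := nonZeroDivisors.ne_zero hh
    exact (FractionalIdeal.mem_one_iff D⁰).1 ((algebraMap_div_mem_one_iff hh).2
      (hD r g h (nonZeroDivisors.ne_zero hr) hh fun n => (key r g h hh n).2 (H n)))

/-- Otherwise `h = g t` with `t` a nonunit, and cancelling `g ^ n` leaves `t ^ n ∣ r` for every `n`.
-/
lemma IsDiscreteValuationRing.dvd_of_pow_dvd {A : Type*} [CommRing A] [IsDomain A]
    [IsDiscreteValuationRing A] {r g h : A} (hr : r ≠ 0) (hh : h ≠ 0)
    (H : ∀ n : ℕ, h ^ n ∣ r * g ^ n) : h ∣ g := by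
  rcases ValuationRing.dvd_total h g with hd | ⟨t, rfl⟩
  · exact hd
  have hg : g ≠ 0 := left_ne_zero_of_mul hh
  by_contra hcon
  have ht : ¬ IsUnit t := fun ht => hcon (ht.mul_right_dvd.2 dvd_rfl)
  obtain ⟨n, hn⟩ := FiniteMultiplicity.of_not_isUnit ht hr
  refine hn ?_
  have := H (n + 1)
  rw [mul_pow, mul_comm r] at this
  exact (mul_dvd_mul_iff_left (pow_ne_zero _ hg)).1 this

variable {D : Type*} [CommRing D] [IsDomain D]

/-- The inclusion of `D` in a valuation overring. -/
noncomputable def ValuationSubring.ofAlgebraMap (V : ValuationSubring (FractionRing D))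
    (hV : ∀ a : D, algebraMap D (FractionRing D) a ∈ V) : D →+* V :=
  (algebraMap D (FractionRing D)).codRestrict V.toSubring hV

lemma ValuationSubring.ofAlgebraMap_injective (V : ValuationSubring (FractionRing D))
    (hV : ∀ a : D, algebraMap D (FractionRing D) a ∈ V) :
    Function.Injective (V.ofAlgebraMap hV) :=
  fun _ _ h => IsFractionRing.injective D (FractionRing D) (congrArg Subtype.val h)

lemma IsKrullDomain.isCompletelyIntegrallyClosed (h : IsKrullDomain D) :
    IsCompletelyIntegrallyClosed D := by
  rw [isCompletelyIntegrallyClosed_iff]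
  obtain ⟨F, hdvr, hmem, -⟩ := h
  intro r g h hr hh H
  rw [← algebraMap_div_mem_one_iff hh, FractionalIdeal.mem_one_iff]
  refine (hmem _).2 fun V hV => ?_
  have := hdvr V hV
  let ψ := V.ofAlgebraMap fun a => (hmem _).1 ⟨a, rfl⟩ V hV
  have hψ : Function.Injective ψ := V.ofAlgebraMap_injective _
  have hh' : ψ h ≠ 0 := by rwa [Ne, map_eq_zero_iff ψ hψ]
  obtain ⟨q, hq⟩ : ψ h ∣ ψ g := by
    refine IsDiscreteValuationRing.dvd_of_pow_dvd (r := ψ r)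
      (by rwa [Ne, map_eq_zero_iff ψ hψ]) hh' fun n => ?_
    rw [← map_pow, ← map_pow, ← map_mul]
    exact map_dvd ψ (H n)
  have : algebraMap D (FractionRing D) g / algebraMap D (FractionRing D) h = q := by
    rw [div_eq_iff (by simpa using hh), mul_comm]
    exact congrArg Subtype.val hq
  rw [this]
  exact q.2

-- The lowest nonzero coefficient of `r` is a common denominator for the powers of the constant term
-- of `q`, which thus lies in `D`. Almost integral elements form a ring, so that term can be
-- subtracted; dividing by `X` then shifts the coefficients for the induction.
open PowerSeries in
lemma IsCompletelyIntegrallyClosed.coeff_mem_range (hD : IsCompletelyIntegrallyClosed D) (N : ℕ) :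
    ∀ q : (FractionRing D)⟦X⟧, (∃ r : D⟦X⟧, r ≠ 0 ∧ ∀ n : ℕ, ∃ c : D⟦X⟧,
      map (algebraMap D (FractionRing D)) r * q ^ n = map (algebraMap D (FractionRing D)) c) →
      coeff N q ∈ (algebraMap D (FractionRing D)).range := by
  set ι := map (algebraMap D (FractionRing D)) with hι
  have hinj : Function.Injective ι := map_injective _ (IsFractionRing.injective D _)
  have h0 : ∀ q : (FractionRing D)⟦X⟧, (∃ r : D⟦X⟧, r ≠ 0 ∧ ∀ n : ℕ, ∃ c : D⟦X⟧,
      ι r * q ^ n = ι c) → constantCoeff q ∈ (algebraMap D (FractionRing D)).range := by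
    rintro q ⟨r, hr, H⟩
    obtain ⟨k, r', hr', rfl⟩ : ∃ k, ∃ r' : D⟦X⟧, constantCoeff r' ≠ 0 ∧ r = X ^ k * r' :=
      ⟨_, _, by rw [constantCoeff_divXPowOrder]; exact coeff_order hr,
        X_pow_order_mul_divXPowOrder.symm⟩
    refine hD _ ⟨constantCoeff r', mem_nonZeroDivisors_of_ne_zero hr', fun n => ?_⟩
    obtain ⟨c, hc⟩ := H n
    refine ⟨coeff (0 + k) c, ?_⟩
    rw [map_mul, map_pow, hι, map_X, mul_assoc] at hc
    have e := congrArg (coeff (0 + k)) hc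
    rw [coeff_map, coeff_X_pow_mul] at e
    rw [← e, Algebra.smul_def, coeff_zero_eq_constantCoeff_apply, map_mul, map_pow,
      ← coeff_zero_eq_constantCoeff_apply (map _ r'), coeff_map, coeff_zero_eq_constantCoeff_apply]
  induction N with
  | zero => simpa using h0
  | succ N ih =>
    intro q hq
    obtain ⟨a, ha⟩ := h0 q hq
    let _ : Algebra D⟦X⟧ (FractionRing D)⟦X⟧ := ι.toAlgebra
    have hq1 : q ∈ completeIntegralClosure D⟦X⟧ (FractionRing D)⟦X⟧ := by
      obtain ⟨r, hr, H⟩ := hq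
      refine ⟨r, mem_nonZeroDivisors_of_ne_zero hr, fun n => ?_⟩
      obtain ⟨c, hc⟩ := H n
      exact ⟨c, hc.symm⟩
    have hq2 : q - ι (C a) ∈ completeIntegralClosure D⟦X⟧ (FractionRing D)⟦X⟧ :=
      sub_mem hq1 (Subalgebra.algebraMap_mem _ (C a))
    obtain ⟨q', hq'⟩ : X ∣ q - ι (C a) := by
      rw [X_dvd_iff, map_sub, hι, map_C, constantCoeff_C, ha, sub_self]
    have e : coeff (N + 1) q = coeff N q' := by
      have := congrArg (coeff (N + 1)) hq'
      rwa [map_sub, hι, map_C, coeff_C, if_neg (Nat.succ_ne_zero N), sub_zero,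
        coeff_succ_X_mul] at this
    rw [e]
    refine ih q' ?_
    obtain ⟨r, hr, H⟩ := hq2
    refine ⟨r, nonZeroDivisors.ne_zero hr, fun n => ?_⟩
    obtain ⟨c, hc⟩ := H n
    have hc : ι c = X ^ n * (ι r * q' ^ n) := by
      have hc : ι c = ι r * (q - ι (C a)) ^ n := hc
      rw [hc, hq', mul_pow]
      ring
    -- The factor `X ^ n` is cancelled for each `n`, so the same multiplier `r` serves `q'`.
    obtain ⟨c', rfl⟩ : X ^ n ∣ c := by
      rw [X_pow_dvd_iff]
      intro k hk
      apply IsFractionRing.injective D (FractionRing D)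
      rw [map_zero, ← coeff_map, ← hι, hc]
      exact X_pow_dvd_iff.1 (dvd_mul_right _ _) k hk
    refine ⟨c', ?_⟩
    rw [map_mul, map_pow, hι, map_X] at hc
    exact (X_pow_mul_cancel hc).symm

open PowerSeries in
lemma mem_range_map_of_coeff_mem_range {q : (FractionRing D)⟦X⟧}
    (h : ∀ n, coeff n q ∈ (algebraMap D (FractionRing D)).range) :
    ∃ c : D⟦X⟧, map (algebraMap D (FractionRing D)) c = q := by
  choose c hc using h
  exact ⟨mk c, by ext n; simp [hc]⟩

-- The quotient `g / h` exists in the discrete valuation ring `K⟦X⟧`, so only its coefficients need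
-- to be placed in `D`.
open PowerSeries in
lemma IsCompletelyIntegrallyClosed.powerSeries (hD : IsCompletelyIntegrallyClosed D) :
    IsCompletelyIntegrallyClosed D⟦X⟧ := by
  rw [isCompletelyIntegrallyClosed_iff]
  intro r g h hr hh H
  set ι := map (algebraMap D (FractionRing D)) with hι
  have hinj : Function.Injective ι := map_injective _ (IsFractionRing.injective D _)
  have hh' : ι h ≠ 0 := by rwa [Ne, map_eq_zero_iff ι hinj]
  obtain ⟨q, hq⟩ : ι h ∣ ι g := by
    refine IsDiscreteValuationRing.dvd_of_pow_dvd (r := ι r)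
      (by rwa [Ne, map_eq_zero_iff ι hinj]) hh' fun n => ?_
    rw [← map_pow, ← map_pow, ← map_mul]
    exact map_dvd ι (H n)
  obtain ⟨c, rfl⟩ := mem_range_map_of_coeff_mem_range (q := q) fun N =>
    hD.coeff_mem_range N q ⟨r, hr, fun n => by
      obtain ⟨c, hc⟩ := H n
      refine ⟨c, mul_left_cancel₀ (pow_ne_zero n hh') ?_⟩
      have := congrArg ι hc
      rw [map_mul, map_mul, map_pow, map_pow, hq] at this
      rw [← this]
      ring⟩
  exact ⟨c, hinj (by rw [hq, map_mul])⟩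

open PowerSeries in
lemma IsCompletelyIntegrallyClosed.of_powerSeries (hD : IsCompletelyIntegrallyClosed D⟦X⟧) :
    IsCompletelyIntegrallyClosed D := by
  rw [isCompletelyIntegrallyClosed_iff] at hD ⊢
  intro r g h hr hh H
  have hC : Function.Injective (C : D →+* D⟦X⟧) := C_injective
  have := hD (C r) (C g) (C h) (by rwa [Ne, map_eq_zero_iff _ hC])
    (by rwa [Ne, map_eq_zero_iff _ hC]) fun n => by
      rw [← map_pow, ← map_pow, ← map_mul]
      exact map_dvd C (H n)
  simpa using map_dvd constantCoeff this

end CompleteIntegralClosure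

/-! ### The H-property from Noetherian overrings -/

section Noetherian

lemma Ideal.exists_fg_map_eq {R B : Type*} [CommRing R] [CommRing B] [IsNoetherianRing B]
    (φ : R →+* B) (I : Ideal R) : ∃ F ≤ I, F.FG ∧ F.map φ = I.map φ := by
  classical
  obtain ⟨s, hs, h⟩ := (Submodule.fg_span_iff_fg_span_finset_subset (φ '' (I : Set R))).1
    (Ideal.fg_of_isNoetherianRing (I.map φ))
  obtain ⟨t, ht, rfl⟩ := Finset.subset_set_image_iff.1 hs
  refine ⟨span (t : Set R), span_le.2 ht, ⟨t, rfl⟩, ?_⟩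
  rw [map_span, ← Finset.coe_image]
  exact h.symm

lemma Ideal.dvd_mul_of_map_eq {R B : Type*} [CommRing R] [CommRing B] (φ : R →+* B)
    {F I : Ideal R} (h : F.map φ = I.map φ) {a b : R} (hF : ∀ f ∈ F, b ∣ a * f) {y : R}
    (hy : y ∈ I) : φ b ∣ φ (a * y) := by
  have hy : φ y ∈ F.map φ := h ▸ Ideal.mem_map_of_mem φ hy
  rw [map_mul]
  generalize φ y = z at hy ⊢
  induction hy using Submodule.span_induction with
  | mem z hz =>
    obtain ⟨f, hf, rfl⟩ := hz
    rw [← map_mul]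
    exact map_dvd φ (hF f hf)
  | zero => simp
  | add x y _ _ hx hy => rw [mul_add]; exact dvd_add hx hy
  | smul r x _ hx => rw [smul_eq_mul, mul_left_comm]; exact hx.mul_left _

/-- An intersection of finite character of Noetherian overrings (with one extra Noetherian
overring `B₀`) is an H-domain. -/
lemma isHDomain_of_isNoetherianRing {R : Type*} [CommRing R] [IsDomain R] {B₀ : Type*}
    [CommRing B₀] [IsNoetherianRing B₀] (φ₀ : R →+* B₀) {ι : Type*} {B : ι → Type*}
    [∀ i, CommRing (B i)] [∀ i, IsNoetherianRing (B i)] (φ : ∀ i, R →+* B i)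
    (hdvd : ∀ a b : R, b ≠ 0 → φ₀ b ∣ φ₀ a → (∀ i, φ i b ∣ φ i a) → b ∣ a)
    (hfin : ∀ d : R, d ≠ 0 → {i | ¬ IsUnit (φ i d)}.Finite) : IsHDomain R := by
  rw [isHDomain_iff]
  intro I hI0 hI
  obtain ⟨d, hd, hd0⟩ := Submodule.exists_mem_ne_zero_of_ne_bot hI0
  obtain ⟨F₀, hF₀, hF₀fg, hF₀map⟩ := I.exists_fg_map_eq φ₀
  choose F hF hFfg hFmap using fun i => I.exists_fg_map_eq (φ i)
  have hle : ∀ i ∈ (hfin d hd0).toFinset, F i ≤ ⨆ i ∈ (hfin d hd0).toFinset, F i :=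
    fun i hi => le_iSup₂ (f := fun i _ => F i) i hi
  -- `F₀` and the finitely many `F i` have the same extension as `I` in their overrings; in every
  -- other `B i`, `d` is a unit and the summand `(d)` suffices.
  refine ⟨Ideal.span {d} ⊔ F₀ ⊔ ⨆ i ∈ (hfin d hd0).toFinset, F i, ?_, ?_, ?_, ?_⟩
  · intro h
    have : d ∈ (⊥ : Ideal R) :=
      h ▸ Ideal.mem_sup_left (Ideal.mem_sup_left (Ideal.mem_span_singleton_self d))
    exact hd0 this
  · exact ((Submodule.fg_span_singleton d).sup hF₀fg).sup
      (Submodule.fg_biSup _ _ fun i _ => hFfg i)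
  · exact sup_le (sup_le ((Ideal.span_singleton_le_iff_mem _).2 hd) hF₀)
      (iSup₂_le fun i _ => hF i)
  · intro a b hb hab
    refine hI a b hb fun y hy => hdvd _ _ hb ?_ fun i => ?_
    · exact Ideal.dvd_mul_of_map_eq φ₀ hF₀map
        (fun f hf => hab f (Ideal.mem_sup_left (Ideal.mem_sup_right hf))) hy
    · by_cases hi : IsUnit (φ i d)
      · have := map_dvd (φ i)
          (hab d (Ideal.mem_sup_left (Ideal.mem_sup_left (Ideal.mem_span_singleton_self d))))
        rw [map_mul, hi.dvd_mul_right] at this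
        rw [map_mul]
        exact this.mul_right _
      · exact Ideal.dvd_mul_of_map_eq (φ i) (hFmap i)
          (fun f hf => hab f (Ideal.mem_sup_right (hle i ((hfin d hd0).mem_toFinset.2 hi) hf))) hy

-- `D⟦X⟧` is the intersection of `K⟦X⟧` and the rings `V⟦X⟧[1/X]`. Inverting `X` is needed for
-- finite character, as `X` is a nonunit in every `V⟦X⟧`; afterwards only the lowest coefficient of
-- a series matters. The extra overring `K⟦X⟧` excludes negative powers of `X`.
open PowerSeries in
lemma IsKrullDomain.isHDomain_powerSeries {D : Type*} [CommRing D] [IsDomain D]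
    (h : IsKrullDomain D) : IsHDomain D⟦X⟧ := by
  obtain ⟨𝓕, hdvr, hmem, hfin⟩ := h
  have hinjK := IsFractionRing.injective D (FractionRing D)
  let ψ (V : 𝓕) : D →+* V.1 := V.1.ofAlgebraMap fun a => (hmem _).1 ⟨a, rfl⟩ V.1 V.2
  have : ∀ V : 𝓕, IsDiscreteValuationRing V.1 := fun V => hdvr V.1 V.2
  have : ∀ V : 𝓕, IsNoetherianRing (Localization.Away (X : V.1⟦X⟧)) :=
    fun V => IsLocalization.isNoetherianRing (Submonoid.powers (X : V.1⟦X⟧)) _ inferInstance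
  let B (V : 𝓕) := Localization.Away (X : V.1⟦X⟧)
  let φ (V : 𝓕) : D⟦X⟧ →+* B V := (algebraMap V.1⟦X⟧ (B V)).comp (map (ψ V))
  refine isHDomain_of_isNoetherianRing (map (algebraMap D (FractionRing D))) φ ?_ ?_
  · rintro a b hb ⟨q, hq⟩ hV
    set ι := map (algebraMap D (FractionRing D)) with hι
    have hinj : Function.Injective ι := map_injective _ hinjK
    have hb' : ι b ≠ 0 := by rwa [Ne, map_eq_zero_iff ι hinj]
    obtain ⟨c, rfl⟩ := mem_range_map_of_coeff_mem_range (q := q) fun N => by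
      refine (hmem _).2 fun V hVF => ?_
      obtain ⟨z, hz⟩ := hV ⟨V, hVF⟩
      obtain ⟨n, p, hp⟩ := IsLocalization.Away.surj (X : V⟦X⟧) z
      have e1 : X ^ n * map (ψ ⟨V, hVF⟩) a = map (ψ ⟨V, hVF⟩) b * p := by
        apply IsLocalization.injective (B ⟨V, hVF⟩)
          (powers_le_nonZeroDivisors_of_noZeroDivisors (X_ne_zero (R := V)))
        have hz : algebraMap V⟦X⟧ (B ⟨V, hVF⟩) (map (ψ ⟨V, hVF⟩) a) =
          algebraMap V⟦X⟧ (B ⟨V, hVF⟩) (map (ψ ⟨V, hVF⟩) b) * z := hz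
        have hp : z * algebraMap V⟦X⟧ (B ⟨V, hVF⟩) X ^ n = algebraMap V⟦X⟧ (B ⟨V, hVF⟩) p := hp
        rw [map_mul, map_mul, map_pow, hz, ← hp]
        ring
      have e2 : ∀ f : D⟦X⟧, map V.subtype (map (ψ ⟨V, hVF⟩) f) = ι f := by
        intro f
        ext k
        simp only [coeff_map, hι]
        rfl
      have e3 := congrArg (map V.subtype) e1
      rw [map_mul, map_mul, map_pow, map_X, e2, e2, hq, mul_left_comm] at e3
      have e4 := congrArg (coeff (N + n)) (mul_left_cancel₀ hb' e3)
      rw [coeff_X_pow_mul, coeff_map] at e4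
      rw [e4]
      exact (coeff (N + n) p).2
    exact ⟨c, hinj (by rw [hq, map_mul])⟩
  · intro d hd
    refine Set.Finite.of_finite_image ((hfin _ (coeff_order hd)).subset ?_)
      Subtype.val_injective.injOn
    rintro _ ⟨V, hV, rfl⟩
    refine ⟨V.2, fun hinv => hV ?_⟩
    have hne : algebraMap D (FractionRing D) (coeff d.order.toNat d) ≠ 0 := by
      simpa using coeff_order hd
    have hu : IsUnit (map (ψ V) (divXPowOrder d)) := by
      rw [isUnit_iff_constantCoeff, ← coeff_zero_eq_constantCoeff_apply, coeff_map,
        coeff_zero_eq_constantCoeff_apply, constantCoeff_divXPowOrder]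
      exact IsUnit.of_mul_eq_one ⟨_, hinv⟩ (Subtype.ext (mul_inv_cancel₀ hne))
    rw [← X_pow_order_mul_divXPowOrder (f := d)]
    change IsUnit (algebraMap V.1⟦X⟧ (B V) (map (ψ V) _))
    rw [map_mul, map_pow, map_X, map_mul, map_pow]
    exact ((IsLocalization.Away.algebraMap_isUnit (X : V.1⟦X⟧)).pow _).mul (hu.map _)

end Noetherian

/-! ### A PVMD of power series forces complete integral closure -/

section PVMD

/-- For `I = (1, x)`, `I⁻¹` consists of the `j` with `j, xj ∈ R`, so the hypothesis says `x I I⁻¹ ⊆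
R`, and `t`-invertibility gives `x ∈ R`. Roots of monic quadratics satisfy the hypothesis. -/
lemma IsPVMD.mem_one_of_sq_mul_mem {R : Type*} [CommRing R] [IsDomain R] (h : IsPVMD R)
    {x : FractionRing R}
    (hx : ∀ j ∈ (1 : FractionalIdeal R⁰ (FractionRing R)),
      x * j ∈ (1 : FractionalIdeal R⁰ (FractionRing R)) →
      x * (x * j) ∈ (1 : FractionalIdeal R⁰ (FractionRing R))) :
    x ∈ (1 : FractionalIdeal R⁰ (FractionRing R)) := by
  let I : FractionalIdeal R⁰ (FractionRing R) :=
    FractionalIdeal.spanSingleton R⁰ 1 + FractionalIdeal.spanSingleton R⁰ x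
  have h1 : (1 : FractionRing R) ∈ I := by
    rw [FractionalIdeal.mem_add]
    exact ⟨1, FractionalIdeal.mem_spanSingleton_self _ _, 0, zero_mem (S := Submodule R _) _,
      add_zero _⟩
  have hxI : x ∈ I := by
    rw [FractionalIdeal.mem_add]
    exact ⟨0, zero_mem (S := Submodule R _) _, x, FractionalIdeal.mem_spanSingleton_self _ _,
      zero_add _⟩
  have hI : I ≠ 0 := by
    intro h
    rw [h, FractionalIdeal.mem_zero_iff] at h1
    exact one_ne_zero h1
  have hfg : (I : Submodule R (FractionRing R)).FG := by
    rw [FractionalIdeal.coe_add, FractionalIdeal.coe_spanSingleton,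
      FractionalIdeal.coe_spanSingleton]
    exact (Submodule.fg_span_singleton _).sup (Submodule.fg_span_singleton _)
  refine (h I hI hfg).mem_one_of_mul_mem hI fun i hi j hj => ?_
  rw [FractionalIdeal.mem_inv_iff hI] at hj
  have hj1 := hj 1 h1
  have hjx := hj x hxI
  rw [mul_one] at hj1
  rw [mul_comm] at hjx
  obtain ⟨y, hy, z, hz, rfl⟩ := (FractionalIdeal.mem_add _ _ _).1 hi
  obtain ⟨α, rfl⟩ := (FractionalIdeal.mem_spanSingleton _).1 hy
  obtain ⟨β, rfl⟩ := (FractionalIdeal.mem_spanSingleton _).1 hz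
  have e : x * ((α • 1 + β • x) * j) = α • (x * j) + β • (x * (x * j)) := by
    simp only [Algebra.smul_def]
    ring
  rw [e]
  exact add_mem (S := Submodule R (FractionRing R))
    (Submodule.smul_mem (1 : FractionalIdeal R⁰ (FractionRing R)).coeToSubmodule α hjx)
    (Submodule.smul_mem (1 : FractionalIdeal R⁰ (FractionRing R)).coeToSubmodule β (hx j hj1 hjx))

variable {D : Type*} [CommRing D] [IsDomain D]

open PowerSeries

/-- The quadratic equation `w = xX + w²` solved by the Catalan series `xX c(xX)`. -/
lemma catalan_rescale_sq {K : Type*} [CommRing K] (x : K) :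
    ∃ w : K⟦X⟧, (∀ n, coeff (n + 1) w = catalan n * x ^ (n + 1)) ∧ coeff 0 w = 0 ∧
      w = C x * X + w ^ 2 := by
  let c : K⟦X⟧ := rescale x (map (Nat.castRingHom K) catalanSeries)
  have hc : c ^ 2 * (C x * X) + 1 = c := by
    have := congrArg (fun f => rescale x (map (Nat.castRingHom K) f))
      catalanSeries_sq_mul_X_add_one
    simpa [rescale_X] using this
  refine ⟨X * (C x * c), fun n => ?_, by simp, ?_⟩
  · rw [coeff_succ_X_mul, coeff_C_mul, coeff_rescale, coeff_map, catalanSeries_coeff, pow_succ]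
    simp only [Nat.coe_castRingHom]
    ring
  · conv_lhs => rw [← hc]
    ring

/-- With `x = g / h`, this says that `b, b' = bx ∈ D` imply `bx² ∈ D`. The series `W = r w` clears
the denominators of the Catalan series `w`. -/
lemma IsPVMD.dvd_mul_of_mul_eq (hP : IsPVMD D⟦X⟧) {r g h : D} (hr : r ≠ 0) (hh : h ≠ 0)
    (H : ∀ n : ℕ, h ^ n ∣ r * g ^ n) {b b' : D} (hb : h * b' = b * g) : h ∣ b' * g := by
  choose c hc using H
  have hinjK := IsFractionRing.injective D (FractionRing D)
  have hh' : algebraMap D (FractionRing D) h ≠ 0 := by simpa using hh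
  set x : FractionRing D := algebraMap D (FractionRing D) g / algebraMap D (FractionRing D) h
    with hx
  have hcx : ∀ n, algebraMap D (FractionRing D) (c n) = algebraMap D (FractionRing D) r * x ^ n := by
    intro n
    have := congrArg (algebraMap D (FractionRing D)) (hc n)
    simp only [map_mul, map_pow] at this
    rw [hx, div_pow, mul_div_assoc', this, mul_div_cancel_left₀ _ (pow_ne_zero n hh')]
  obtain ⟨w, hw1, hw0, hw⟩ := catalan_rescale_sq x
  set ι := map (algebraMap D (FractionRing D)) with hι
  have hinj : Function.Injective ι := map_injective _ hinjK
  obtain ⟨W, hWdef⟩ : ∃ W : D⟦X⟧, W = X * PowerSeries.mk fun n => (catalan n : D) * c (n + 1) :=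
    ⟨_, rfl⟩
  have hW : ι W = C (algebraMap D (FractionRing D) r) * w := by
    ext n
    rw [hι, coeff_map, coeff_C_mul]
    cases n with
    | zero => simp [hWdef, hw0]
    | succ n =>
      rw [hWdef, coeff_succ_X_mul, coeff_mk, hw1, map_mul, map_natCast, hcx]
      ring
  have hWsq : W ^ 2 = C r * W - C (r * c 1) * X := by
    apply hinj
    have h1 : C (algebraMap D (FractionRing D) (r * c 1)) =
        C (algebraMap D (FractionRing D) r) ^ 2 * C x := by
      rw [← map_pow, ← map_mul, map_mul, hcx, pow_one]
      congr 1
      ring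
    rw [map_sub, map_pow, map_mul, map_mul, hW, hι, map_C, map_C, map_X, h1]
    linear_combination -(C (algebraMap D (FractionRing D) r)) ^ 2 * hw
  have hbx : b * c 1 = r * b' := by
    apply mul_left_cancel₀ hh
    have := hc 1
    rw [pow_one, pow_one] at this
    linear_combination -b * this - r * hb
  have hCr : (C r : D⟦X⟧) ≠ 0 := by rwa [Ne, map_eq_zero_iff _ C_injective]
  have hCr' : algebraMap D⟦X⟧ (FractionRing D⟦X⟧) (C r) ≠ 0 := by simpa using hCr
  -- The quotient `bW / r = bw` is integral over `D⟦X⟧`, as a root of `Y² = bY - bb'X`.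
  have key : algebraMap D⟦X⟧ (FractionRing D⟦X⟧) (C b * W) /
      algebraMap D⟦X⟧ (FractionRing D⟦X⟧) (C r) ∈
        (1 : FractionalIdeal D⟦X⟧⁰ (FractionRing D⟦X⟧)) := by
    set Y := algebraMap D⟦X⟧ (FractionRing D⟦X⟧) (C b * W) /
      algebraMap D⟦X⟧ (FractionRing D⟦X⟧) (C r) with hY
    have hYsq : Y * Y = algebraMap D⟦X⟧ (FractionRing D⟦X⟧) (C b) * Y -
        algebraMap D⟦X⟧ (FractionRing D⟦X⟧) (C (b * b') * X) := by
      have h2 : (C b * W) * (C b * W) = C b * C r * (C b * W) - C r ^ 2 * (C (b * b') * X) := by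
        have h3 := congrArg (C : D → D⟦X⟧) hbx
        simp only [map_mul] at h3 hWsq ⊢
        linear_combination C b ^ 2 * hWsq - C b * C r * X * h3
      have h4 := congrArg (algebraMap D⟦X⟧ (FractionRing D⟦X⟧)) h2
      rw [map_mul, map_sub, map_mul _ (C b * C r), map_mul _ (C b) (C r), map_mul _ (C r ^ 2),
        map_pow] at h4
      have h5 : algebraMap D⟦X⟧ (FractionRing D⟦X⟧) (C b * W) =
          Y * algebraMap D⟦X⟧ (FractionRing D⟦X⟧) (C r) := by
        rw [hY, div_mul_cancel₀ _ hCr']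
      rw [h5] at h4
      apply mul_left_cancel₀ (pow_ne_zero 2 hCr')
      linear_combination h4
    refine hP.mem_one_of_sq_mul_mem fun j hj hYj => ?_
    rw [← mul_assoc, hYsq, sub_mul, mul_assoc, ← Algebra.smul_def, ← Algebra.smul_def]
    exact sub_mem (S := Submodule D⟦X⟧ (FractionRing D⟦X⟧))
      (Submodule.smul_mem (1 : FractionalIdeal D⟦X⟧⁰ (FractionRing D⟦X⟧)).coeToSubmodule _ hYj)
      (Submodule.smul_mem (1 : FractionalIdeal D⟦X⟧⁰ (FractionRing D⟦X⟧)).coeToSubmodule _ hj)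
  obtain ⟨y, hy⟩ := (algebraMap_div_mem_one_iff hCr).1 key
  -- Since `catalan 1 = 1`, the coefficient of `bw` at `X²` is exactly `bx²`.
  have h2 := congrArg (coeff 2) hy
  rw [coeff_C_mul, coeff_C_mul, hWdef, show 2 = 1 + 1 from rfl, coeff_succ_X_mul, coeff_mk, catalan_one,
    Nat.cast_one, one_mul] at h2
  refine ⟨coeff 2 y, ?_⟩
  have h3 := hc 2
  apply mul_left_cancel₀ hr
  apply mul_left_cancel₀ hh
  linear_combination r * g * hb + b * h3 + h ^ 2 * h2

/-- If `D⟦X⟧` is a PVMD, then `D` is completely integrally closed. -/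
lemma IsPVMD.isCompletelyIntegrallyClosed (hP : IsPVMD D⟦X⟧) :
    IsCompletelyIntegrallyClosed D := by
  rw [isCompletelyIntegrallyClosed_iff]
  intro r g h hr hh H
  have hCh : (C h : D⟦X⟧) ≠ 0 := by rwa [Ne, map_eq_zero_iff _ C_injective]
  suffices hd : (C h : D⟦X⟧) ∣ C g by simpa using map_dvd constantCoeff hd
  rw [← algebraMap_div_mem_one_iff hCh]
  -- The criterion is used in `D⟦X⟧`, the ring known to be a PVMD, for the constant `x = g / h`; its
  -- hypothesis is checked coefficientwise.
  refine hP.mem_one_of_sq_mul_mem fun j hj hxj => ?_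
  obtain ⟨f, rfl⟩ := (FractionalIdeal.mem_one_iff _).1 hj
  rw [div_mul_eq_mul_div, ← map_mul, algebraMap_div_mem_one_iff hCh] at hxj
  obtain ⟨f', hf'⟩ := hxj
  have e : algebraMap D⟦X⟧ (FractionRing D⟦X⟧) (C g) / algebraMap D⟦X⟧ (FractionRing D⟦X⟧) (C h) *
      algebraMap D⟦X⟧ (FractionRing D⟦X⟧) f = algebraMap D⟦X⟧ (FractionRing D⟦X⟧) f' := by
    rw [div_mul_eq_mul_div, ← map_mul, hf', map_mul, mul_div_cancel_left₀ _ (by simpa using hCh)]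
  rw [e, div_mul_eq_mul_div, ← map_mul, algebraMap_div_mem_one_iff hCh]
  have : ∀ n, h ∣ coeff n f' * g := by
    intro n
    refine hP.dvd_mul_of_mul_eq hr hh H (b := coeff n f) ?_
    have := congrArg (coeff n) hf'
    rw [coeff_C_mul, coeff_C_mul] at this
    rw [← this, mul_comm]
  choose k hk using this
  refine ⟨PowerSeries.mk k, ?_⟩
  ext n
  rw [coeff_C_mul, coeff_C_mul, coeff_mk, ← hk, mul_comm]

end PVMD

/-! ### Completely integrally closed Krull-like PVMDs are Krull -/

section KrullLike

variable {D : Type*} [CommRing D] [IsDomain D]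

lemma exists_notMem_dvd_mul_of_dvd {M : Ideal D} [M.IsPrime] {a b : D}
    (h : algebraMap D (Localization.AtPrime M) a ∣ algebraMap D (Localization.AtPrime M) b) :
    ∃ u ∉ M, a ∣ u * b := by
  obtain ⟨z, hz⟩ := h
  obtain ⟨⟨c, u⟩, hc⟩ := IsLocalization.surj M.primeCompl z
  refine ⟨u, u.2, c, ?_⟩
  apply IsLocalization.injective (Localization.AtPrime M) M.primeCompl_le_nonZeroDivisors
  rw [map_mul, map_mul, hz, ← hc]
  ring

lemma IsStronglyDiscreteValuationDomain.dvd_or_dvd {M : Ideal D} [M.IsPrime]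
    (h : IsStronglyDiscreteValuationDomain (Localization.AtPrime M)) (a b : D) :
    (∃ u ∉ M, a ∣ u * b) ∨ (∃ u ∉ M, b ∣ u * a) := by
  obtain ⟨_, hv, -⟩ := h
  exact (ValuationRing.dvd_total (algebraMap D (Localization.AtPrime M) a) (algebraMap D _ b)).imp
    exists_notMem_dvd_mul_of_dvd exists_notMem_dvd_mul_of_dvd

/-- Any `x` in the maximal ideal `P` but not in `P ^ 2` generates `P`: if `x = y t` with `y ∈ P`,
then `t` must be a unit. -/
lemma IsStronglyDiscreteValuationDomain.exists_generator {M : Ideal D} [hM : M.IsPrime]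
    (h0 : M ≠ ⊥) (h : IsStronglyDiscreteValuationDomain (Localization.AtPrime M)) :
    ∃ m ∈ M, ∀ y ∈ M, ∃ u ∉ M, m ∣ u * y := by
  obtain ⟨_, hv, hs⟩ := h
  set P := IsLocalRing.maximalIdeal (Localization.AtPrime M) with hP
  have hmem : ∀ a : D, algebraMap D (Localization.AtPrime M) a ∈ P ↔ a ∈ M := fun a =>
    IsLocalization.AtPrime.to_map_mem_maximal_iff _ M a
  have hP0 : P ≠ ⊥ := by
    intro hb
    obtain ⟨z, hz, hz0⟩ := Submodule.exists_mem_ne_zero_of_ne_bot h0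
    have := (hmem z).2 hz
    rw [hb, Ideal.mem_bot, IsLocalization.to_map_eq_zero_iff _ M.primeCompl_le_nonZeroDivisors]
      at this
    exact hz0 this
  have hlt : ¬ P ≤ P ^ 2 := fun hle =>
    hs P inferInstance hP0 (le_antisymm hle (Ideal.pow_le_self two_ne_zero))
  obtain ⟨x, hx, hx2⟩ := SetLike.not_le_iff_exists.1 hlt
  obtain ⟨⟨m, u⟩, hm⟩ := IsLocalization.surj M.primeCompl x
  have hu : IsUnit (algebraMap D (Localization.AtPrime M) u) := IsLocalization.map_units _ u
  refine ⟨m, (hmem m).1 (hm ▸ P.mul_mem_right _ hx), fun y hy => exists_notMem_dvd_mul_of_dvd ?_⟩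
  rw [← hm, hu.mul_right_dvd]
  rcases ValuationRing.dvd_total x (algebraMap D (Localization.AtPrime M) y) with hd | ⟨t, ht⟩
  · exact hd
  · by_cases htu : IsUnit t
    · rw [ht, htu.mul_right_dvd]
    · refine absurd ?_ hx2
      rw [ht, pow_two]
      exact Ideal.mul_mem_mul ((hmem y).2 hy) htu

lemma IsKrullLikePVMD.exists_isUniformizerAt (h : IsKrullLikePVMD D)
    (hc : IsCompletelyIntegrallyClosed D) {M : Ideal D} (hM : M.IsMaximalProperT) :
    ∃ m, M.IsUniformizerAt m := by
  obtain ⟨hP, hloc, hmin⟩ := h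
  have hMp := hM.isPrime
  obtain ⟨m, hm, hgen⟩ := (hloc M (isMaximalTIdeal_iff.2 hM)).exists_generator hM.1
  refine ⟨m, Ideal.isUniformizerAt_of_forall_exists hMp hM.1 hm hgen fun c H => ?_⟩
  by_contra hc0
  have hm0 : m ≠ 0 := by
    rintro rfl
    obtain ⟨u, hu, hd⟩ := H 1
    rw [pow_one, zero_dvd_iff, mul_eq_zero, or_iff_left hc0] at hd
    exact hu (hd ▸ M.zero_mem)
  -- Prime avoidance over the finitely many minimal primes of `(m)`; `M` is removed because it may
  -- be one of them.
  obtain ⟨z, hzM, hz⟩ : ∃ z ∈ M, ∀ P ∈ (Ideal.span {m}).minimalPrimes, P ≠ M → z ∉ P := by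
    have hfin : ((Ideal.span {m}).minimalPrimes \ {M}).Finite := (hmin m).subset Set.sdiff_subset
    have := (Ideal.subset_union_prime_finite (R := D) hfin (f := id) ⊥ ⊥
      (fun P hP _ _ => hP.1.1.1) (I := M)).not.2 (by
        rintro ⟨P, hP, hMP⟩
        exact hP.2 (le_antisymm
          (hP.1.2 ⟨hMp, (Ideal.span_singleton_le_iff_mem _).2 hm⟩ hMP) hMP))
    obtain ⟨z, hzM, hz⟩ := Set.not_subset.1 this
    refine ⟨z, hzM, fun P hP hPM hzP => hz ?_⟩
    exact Set.mem_biUnion (x := P) ⟨hP, hPM⟩ hzP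
  set I : Ideal D := Ideal.span {m, z} with hI
  have hmI : m ∈ I := Ideal.subset_span (by simp)
  have hzI : z ∈ I := Ideal.subset_span (by simp)
  have hI0 : (I : FractionalIdeal D⁰ (FractionRing D)) ≠ 0 := by
    rw [FractionalIdeal.coeIdeal_ne_zero]
    intro h
    rw [h] at hmI
    exact hm0 hmI
  have hIfg : ((I : FractionalIdeal D⁰ (FractionRing D)) : Submodule D (FractionRing D)).FG := by
    rw [FractionalIdeal.coeIdeal_fg D⁰ (IsFractionRing.injective D (FractionRing D))]
    exact Submodule.fg_span (Set.toFinite _)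
  obtain ⟨i, hi, s, hs, his⟩ := (hP _ hI0 hIfg).exists_mul_notMem hI0 hM.2.1
  obtain ⟨p, q, hq, rfl⟩ := IsFractionRing.div_surjective (A := D) s
  have hq := nonZeroDivisors.ne_zero hq
  have hq' : algebraMap D (FractionRing D) q ≠ 0 := by simpa using hq
  have hpI : ∀ y ∈ I, q ∣ p * y := by
    intro y hy
    rw [← algebraMap_div_mem_one_iff hq, map_mul, ← div_mul_eq_mul_div]
    exact (FractionalIdeal.mem_inv_iff hI0).1 hs _ (FractionalIdeal.mem_coeIdeal_of_mem _ hy)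
  obtain ⟨e, he⟩ := hpI m hmI
  obtain ⟨f, hf⟩ := hpI z hzI
  -- With `s = p / q`, `e = sm` and `f = sz`. Locally `m` divides `z`, so `e ∈ M` would force `f ∈
  -- M` and hence `sI ⊆ M`, against the choice of `s`.
  have heM : e ∉ M := by
    intro heM
    obtain ⟨u, hu, t, ht⟩ := hgen z hzM
    have hfM : f ∈ M := by
      have : u * f = e * t := by
        apply mul_left_cancel₀ hq
        linear_combination -u * hf + p * ht + t * he
      exact (hMp.mem_or_mem (this ▸ M.mul_mem_right _ heM)).resolve_left hu
    obtain ⟨y, hy, rfl⟩ := (FractionalIdeal.mem_coeIdeal _).1 hi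
    obtain ⟨α, β, rfl⟩ := Ideal.mem_span_pair.1 hy
    refine his ((FractionalIdeal.mem_coeIdeal _).2
      ⟨α * e + β * f, add_mem (M.mul_mem_left _ heM) (M.mul_mem_left _ hfM), ?_⟩)
    rw [mul_div_assoc', eq_div_iff hq', ← map_mul, ← map_mul]
    congr 1
    linear_combination -α * he - β * hf
  -- `mc` is a common denominator for all `s ^ n`, checked at each maximal `t`-ideal `N`. At `M`, `m
  -- ^ n` divides `c`; where `m ∉ N`, `m` is a unit; elsewhere `z ^ n` divides `m`, as the reverse
  -- would put `z` in a minimal prime of `(m)` other than `M`.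
  obtain ⟨t, rfl⟩ : q ∣ p := by
    refine isCompletelyIntegrallyClosed_iff.1 hc (m * c) p q (mul_ne_zero hm0 hc0) hq
      fun n => dvd_of_forall_isMaximalProperT (pow_ne_zero n hq) fun N hN => ?_
    have hNp := hN.isPrime
    by_cases hNM : N = M
    · subst hNM
      obtain ⟨u, hu, d, hd⟩ := H n
      refine ⟨u, hu, m * d * e ^ n, ?_⟩
      have h2 : p ^ n * m ^ n = q ^ n * e ^ n := by rw [← mul_pow, he, mul_pow]
      linear_combination m * p ^ n * hd + m * d * h2
    · by_cases hmN : m ∈ N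
      · obtain ⟨P, hPmin, hPN⟩ := Ideal.exists_minimalPrimes_le
          ((Ideal.span_singleton_le_iff_mem N).2 hmN)
        have hPp : P.IsPrime := hPmin.1.1
        have hzP := hz P hPmin (by
          rintro rfl
          exact hNM (hM.2.2 N hPN hN.2.1))
        have hmP : m ∈ P := (Ideal.span_singleton_le_iff_mem _).1 hPmin.1.2
        rcases (hloc N (isMaximalTIdeal_iff.2 hN)).dvd_or_dvd (z ^ n) m with
          ⟨u, hu, d, hd⟩ | ⟨u, hu, hd⟩
        · refine ⟨u, hu, c * d * f ^ n, ?_⟩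
          have h2 : p ^ n * z ^ n = q ^ n * f ^ n := by rw [← mul_pow, hf, mul_pow]
          linear_combination c * p ^ n * hd + c * d * h2
        · exact absurd (P.mem_of_dvd hd hmP)
            (hPp.mul_notMem (fun h => hu (hPN h)) fun h => hzP (hPp.mem_of_pow_mem _ h))
      · refine ⟨m ^ n, fun h => hmN (hNp.mem_of_pow_mem _ h), m * c * e ^ n, ?_⟩
        have h2 : p ^ n * m ^ n = q ^ n * e ^ n := by rw [← mul_pow, he, mul_pow]
        linear_combination m * c * h2
  have : t * m = e := by
    apply mul_left_cancel₀ hq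
    linear_combination he
  exact heM (this ▸ M.mul_mem_left _ hm)

/-- Since the localizations have rank one, maximal `t`-ideals through `d` are minimal primes of
`(d)`, so finite character is the finiteness assumption on minimal primes. -/
lemma IsKrullLikePVMD.isKrullDomain (h : IsKrullLikePVMD D)
    (hc : IsCompletelyIntegrallyClosed D) : IsKrullDomain D := by
  refine isKrullDomain_of_isUniformizerAt (fun M hM => h.exists_isUniformizerAt hc hM)
    fun d hd => (h.2.2 d).subset ?_
  rintro M ⟨hM, hdM⟩
  have hMp := hM.isPrime
  refine ⟨⟨hMp, (Ideal.span_singleton_le_iff_mem _).2 hdM⟩, ?_⟩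
  rintro P ⟨hP, hdP⟩ hPM y hy
  obtain ⟨m, hm⟩ := h.exists_isUniformizerAt hc hM
  obtain ⟨n, u, hu, hdvd⟩ := hm.exists_dvd_mul_pow hd hy
  have := P.mem_of_dvd hdvd ((Ideal.span_singleton_le_iff_mem _).1 hdP)
  exact hP.mem_of_pow_mem n ((hP.mem_or_mem this).resolve_left fun h => hu (hPM h))

end KrullLike

theorem corollary1p8 (D : Type*) [CommRing D] [IsDomain D] :
    (IsHDomain D →
      List.TFAE [IsPVMD D⟦X⟧, IsCompletelyIntegrallyClosed D, IsKrullDomain D,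
        IsCompletelyIntegrallyClosed D⟦X⟧]) ∧
    (IsKrullLikePVMD D → (IsKrullLikePVMD D⟦X⟧ ↔ IsKrullDomain D)) := by
  refine ⟨fun hH => ?_, fun hD => ⟨fun h => ?_, fun h => ?_⟩⟩
  · tfae_have 1 → 2 := IsPVMD.isCompletelyIntegrallyClosed
    tfae_have 2 → 3 := fun h => isKrullDomain_of_isHDomain h hH
    tfae_have 3 → 1 := fun h =>
      isPVMD_of_isHDomain h.isCompletelyIntegrallyClosed.powerSeries h.isHDomain_powerSeries
    tfae_have 2 → 4 := IsCompletelyIntegrallyClosed.powerSeries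
    tfae_have 4 → 2 := IsCompletelyIntegrallyClosed.of_powerSeries
    tfae_finish
  · exact hD.isKrullDomain h.1.isCompletelyIntegrallyClosed
  · exact isKrullLikePVMD_of_isHDomain h.isCompletelyIntegrallyClosed.powerSeries
      h.isHDomain_powerSeries
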